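/- Let $k\ge 1$, let $\Sigma$ be a (known) positive definite $k\times k$ matrix, write $\|x\|_\Sigma^2=x^T\Sigma^{-1}x$, and let $0<d<1$. For $c>0$ consider the Exponential-Inverse-Gamma model for one observation $X$ with mean $\theta\in\mathbb R^k$: $X\mid\theta\sim N_k(\theta,\Sigma)$; $\theta\mid\lambda^2,\tau\sim N_k(0,\lambda^2\tau\Sigma)$; $\lambda^2$ and $\tau$ are independent with densities $\pi(\lambda^2)\propto e^{-\lambda^2/2}$ and $\pi(\tau)\propto e^{-c/(2\tau)}\tau^{-d-1}$ on $(0,\infty)$. Let $\Pi(\cdot\mid X)$ be the posterior law of $\theta$, let $\widehat\theta=E(\theta\mid X)$, let $\widehat r(\alpha,c)$ be determined by $\Pi(\|\theta-\widehat\theta\|_\Sigma^2\le\widehat r(\alpha,c)\mid X)=1-\alpha$, and, for $\rho,L>0$, put $$\widehat C=\{\theta:\ \|\theta-\widehat\theta\|_\Sigma^2\le L\,\widehat r(\alpha,c)^{d/(1+\rho)}\}.$$ For constants $K'_S,K'_M,K'_L>0$ and a function $f'$ put $$\mathcal S'_c=\{\theta_0:\|\theta_0\|_\Sigma^2\le K'_Sc\},\quad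 \mathcal M'_c=\{\theta_0: f'(c)\,c\le\|\theta_0\|_\Sigma^2\le K'_M\log\tfrac1c\},\quad \mathcal L'_c=\{\theta_0:\|\theta_0\|_\Sigma^2\ge K'_L\log\tfrac1c\}.$$ Let $\chi^2_{k,p}$ be the upper $p$-quantile of the chi-squared law with $k$ degrees of freedom. Theorem. There is a function $f'$ with $f'(c)\to\infty$ and $f'(c)\,c\to0$ as $c\downarrow0$, depending on none of the parameters above, such that the following holds. Let $K'_S>0$, $0<K'_M<2d$, $K'_L>2d$, $0<\alpha<1/2$, $\alpha<\beta<1$, $\rho>0$ and $L>\chi^2_{k,\alpha}(\chi^2_{k,\beta})^{-d/(1+\rho)}$, and let $c_n>0$, $c_n\to0$. Let $\widehat C$ be computed with $c=c_n$, and let $P_{\theta_0}$ denote probability when $X\sim N_k(\theta_0,\Sigma)$. Then, as $n\to\infty$: 1. $P_{\theta_0}(\theta_0\in\widehat C)\ge1-\alpha$ for all $\theta_0\in\mathcal S'_{c_n}$, for all sufficiently large $n$; 2. $P_{\theta_0}(\theta_0\notin\widehat C)\to1$ uniformly over $\theta_0\in\mathcal M'_{c_n}$; 3. $P_{\theta_0}(\theta_0\in\widehat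 C)\ge1-\alpha$ for all $\theta_0\in\mathcal L'_{c_n}$, for all sufficiently large $n$. -/

import Mathlib

open MeasureTheory ProbabilityTheory Filter Topology Set Matrix
open scoped ENNReal

noncomputable section

namespace EIG

variable {k : ℕ}

/-- The squared Mahalanobis norm `xᵀ V⁻¹ x`. -/
def mahalSq (V : Matrix (Fin k) (Fin k) ℝ) (x : EuclideanSpace ℝ (Fin k)) : ℝ :=
  x.ofLp ⬝ᵥ (V⁻¹ *ᵥ x.ofLp)

/-- The measure `μ` divided by its total mass. -/
def normalized {Ω : Type*} [MeasurableSpace Ω] (μ : Measure Ω) : Measure Ω :=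
  (μ univ)⁻¹ • μ

/-- The prior of `τ`: the inverse-gamma law, with density proportional to
`exp (-c / (2 τ)) τ ^ (-d - 1)` on `(0, ∞)`. -/
def invGammaPrior (d c : ℝ) : Measure ℝ :=
  normalized ((volume.restrict (Ioi 0)).withDensity
    fun t => ENNReal.ofReal (Real.exp (-c / (2 * t)) * t ^ (-d - 1)))

/-- The joint prior of `(λ², τ)`: independent, `λ²` exponential with density proportional to
`exp (-λ² / 2)`, and `τ` inverse-gamma. -/
def scalePrior (d c : ℝ) : Measure (ℝ × ℝ) :=
  (expMeasure (1 / 2)).prod (invGammaPrior d c)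

/-- The prior of the mean vector `θ`: given `(λ², τ)`, it is `N(0, λ² τ V)`. -/
def meanPrior (V : Matrix (Fin k) (Fin k) ℝ) (d c : ℝ) :
    Measure (EuclideanSpace ℝ (Fin k)) :=
  (scalePrior d c).bind fun p => multivariateGaussian 0 ((p.1 * p.2) • V)

section

open scoped MatrixOrder

theorem gauss_smul {V : Matrix (Fin k) (Fin k) ℝ} (hV : V.PosSemidef) {s : ℝ} (hs : 0 ≤ s) :
    multivariateGaussian 0 (s • V) =
      (multivariateGaussian 0 V).map fun z => Real.sqrt s • z := by
  have h : CFC.sqrt (s • V) = Real.sqrt s • CFC.sqrt V := by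
    have hV' : 0 ≤ V := hV.nonneg
    rw [CFC.sqrt_eq_iff _ _ (smul_nonneg hs hV') (smul_nonneg (Real.sqrt_nonneg s) (CFC.sqrt_nonneg V))]
    rw [smul_mul_smul_comm, Real.mul_self_sqrt hs, CFC.sqrt_mul_sqrt_self V hV']
  rw [multivariateGaussian, multivariateGaussian, Measure.map_map (by fun_prop) (by fun_prop), h]
  congr 1
  ext x
  simp [map_smul]

instance (d c : ℝ) : SFinite (invGammaPrior d c) := by
  unfold invGammaPrior normalized; infer_instance

theorem ae_pos (d c : ℝ) : ∀ᵐ p ∂(scalePrior d c), 0 ≤ p.1 * p.2 := by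
  have h2 : ∀ᵐ t ∂(invGammaPrior d c), 0 ≤ t := by
    refine Measure.ae_smul_measure ?_ _
    refine (withDensity_absolutelyContinuous _ _).ae_le ?_
    filter_upwards [ae_restrict_mem measurableSet_Ioi] with t ht using le_of_lt ht
  have h1 : ∀ᵐ t ∂(expMeasure (1/2)), 0 ≤ t := by
    rw [ae_iff]
    have : {a : ℝ | ¬ 0 ≤ a} = Iio 0 := by ext; simp
    rw [this, expMeasure, gammaMeasure, withDensity_apply _ measurableSet_Iio]
    exact lintegral_gammaPDF_of_nonpos le_rfl
  have := isProbabilityMeasure_expMeasure (r := 1/2) (by norm_num)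
  have a1 : ∀ᵐ p ∂(scalePrior d c), 0 ≤ p.1 := Measure.quasiMeasurePreserving_fst.ae h1
  have a2 : ∀ᵐ p ∂(scalePrior d c), 0 ≤ p.2 := Measure.quasiMeasurePreserving_snd.ae h2
  filter_upwards [a1, a2] with p h h' using mul_nonneg h h'

/-- The conditional law of `θ` depends measurably on `(λ², τ)`, so that the mixture `meanPrior` is the
expected one. -/
theorem aemeasurable_kernel {V : Matrix (Fin k) (Fin k) ℝ} (hV : V.PosSemidef) (d c : ℝ) :
    AEMeasurable (fun p : ℝ × ℝ => multivariateGaussian (0 : EuclideanSpace ℝ (Fin k))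
      ((p.1 * p.2) • V)) (scalePrior d c) := by
  refine ⟨fun p => (multivariateGaussian 0 V).map fun z => Real.sqrt (p.1 * p.2) • z, ?_, ?_⟩
  · refine Measure.measurable_of_measurable_coe _ fun s hs => ?_
    have : (fun p : ℝ × ℝ => (multivariateGaussian (0 : EuclideanSpace ℝ (Fin k)) V).map
        (fun z => Real.sqrt (p.1 * p.2) • z) s) = fun p =>
        (multivariateGaussian (0 : EuclideanSpace ℝ (Fin k)) V)
          (Prod.mk p ⁻¹' {q : (ℝ × ℝ) × EuclideanSpace ℝ (Fin k) |
            Real.sqrt (q.1.1 * q.1.2) • q.2 ∈ s}) := by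
      ext p
      rw [Measure.map_apply (by fun_prop) hs]; rfl
    rw [this]
    apply measurable_measure_prodMk_left
    exact measurableSet_preimage (by fun_prop) hs
  · filter_upwards [ae_pos d c] with p hp using gauss_smul hV hp

end

/-- The posterior law of `θ` given the observation `X = x`, where `X ∣ θ ∼ N(θ, V)`: Bayes' formula
with the Gaussian likelihood (whose normalizing constant does not depend on `θ`, and cancels). -/
def posterior (V : Matrix (Fin k) (Fin k) ℝ) (d c : ℝ) (x : EuclideanSpace ℝ (Fin k)) :
    Measure (EuclideanSpace ℝ (Fin k)) :=
  normalized ((meanPrior V d c).withDensity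
    fun θ => ENNReal.ofReal (Real.exp (-mahalSq V (x - θ) / 2)))

/-- The posterior mean. -/
def estimator (V : Matrix (Fin k) (Fin k) ℝ) (d c : ℝ) (x : EuclideanSpace ℝ (Fin k)) :
    EuclideanSpace ℝ (Fin k) :=
  ∫ θ, θ ∂(posterior V d c x)

/-- The squared radius of the posterior ball of mass `1 - α` about the posterior mean, that is,
the `(1 - α)`-quantile of the posterior law of `‖θ - θ̂‖²` in the Mahalanobis norm. That law is
continuous, so that the ball has posterior mass exactly `1 - α`. -/
def radius (V : Matrix (Fin k) (Fin k) ℝ) (d c α : ℝ) (x : EuclideanSpace ℝ (Fin k)) : ℝ :=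
  sInf {r : ℝ | 1 - α ≤ (posterior V d c x).real {θ | mahalSq V (θ - estimator V d c x) ≤ r}}

/-- The credible set computed from the observation `x`. -/
def credibleSet (V : Matrix (Fin k) (Fin k) ℝ) (d c α ρ L : ℝ) (x : EuclideanSpace ℝ (Fin k)) :
    Set (EuclideanSpace ℝ (Fin k)) :=
  {θ | mahalSq V (θ - estimator V d c x) ≤ L * radius V d c α x ^ (d / (1 + ρ))}

/-- The chi-squared law with `k` degrees of freedom: the law of the sum of the squares of `k`
independent standard normal variables. -/
def chiSq (k : ℕ) : Measure ℝ :=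
  (Measure.pi fun _ : Fin k => gaussianReal 0 1).map fun z => ∑ i, z i ^ 2

/-- The upper `p`-quantile of the chi-squared law with `k` degrees of freedom: the number that is
exceeded with probability `p`. -/
def chiSqUpper (k : ℕ) (p : ℝ) : ℝ :=
  sInf {t : ℝ | (chiSq k).real (Ioi t) ≤ p}

/-- The small means. -/
def smallMeans (V : Matrix (Fin k) (Fin k) ℝ) (K c : ℝ) : Set (EuclideanSpace ℝ (Fin k)) :=
  {θ | mahalSq V θ ≤ K * c}

/-- The intermediate means. -/
def mediumMeans (V : Matrix (Fin k) (Fin k) ℝ) (f : ℝ → ℝ) (K c : ℝ) :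
    Set (EuclideanSpace ℝ (Fin k)) :=
  {θ | f c * c ≤ mahalSq V θ ∧ mahalSq V θ ≤ K * Real.log (1 / c)}

/-- The large means. -/
def largeMeans (V : Matrix (Fin k) (Fin k) ℝ) (K c : ℝ) : Set (EuclideanSpace ℝ (Fin k)) :=
  {θ | K * Real.log (1 / c) ≤ mahalSq V θ}

end EIG

end

/-! Multiplying by the square root of `V` reduces everything to identity covariance, with
Mahalanobis norms becoming Euclidean ones. Write X as the image of `y`, put `u = ‖y‖ ^ 2`, and let s
= λ²τ. Integrating the exponential variable against the inverse-gamma one gives s a Lomax prior,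
with density proportional to `(c + s) ^ (-d - 1)`. Gaussian conjugacy then makes the posterior a
normal mixture: given s, θ is N(κy, κI) with κ = s / (1 + s), and s has density proportional to
`scaleWeight`. The posterior mean is `m • y`, where m = E(κ | X), so all questions become estimates
of one-dimensional integrals in s.

Two estimates govern m (`lintegral_shrink_le`, `lintegral_inv_one_add_le`). Always m = O(c^d
e^(u/2)), so m is polynomially small in `c` when u ≤ K' log(1/c) with K' < 2d. When u ≥ K' log(1/c)
with K' > 2d, 1 - m = O(u^(-3/4)). The radius is bounded above by Markov's inequality
(`one_sub_le_posterior_ball`) and below because a Gaussian gives no ball more mass than the centred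
ball of the same radius (`le_radius`).

Put e = d / (1 + ρ) < d < 1. All three claims are checked on a noise event ‖z‖² ≤ M of prescribed
probability. Small means: the squared error is O(c + c^(2d)), the radius is at least a multiple of
c, and its power c^e dominates. Intermediate means: the estimator is pulled to nearly 0, so the
squared error is at least about 1 / (2 log(1/c)), while the inflated radius is at most a positive
power of c. Taking f'(c)c = 1 / log(1/c) makes the former win. Large means: the bias (1 - m)‖y‖ =
O(u^(-1/4)) vanishes and the radius is eventually above any level below χ²_β, so the lower bound on
L gives coverage. -/

namespace EIG

/-! ### Standard Gaussian law: density, conjugacy, mass of balls, chi-squared law. -/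

section StdGaussian

variable {k : ℕ}

/-- The density of the standard Gaussian law on `ℝᵏ`. -/
noncomputable def stdDensity (k : ℕ) (z : EuclideanSpace ℝ (Fin k)) : ℝ :=
  (Real.pi / (1 / 2)) ^ (-(k / 2 : ℝ)) * Real.exp (-(1 / 2) * ‖z‖ ^ 2)

theorem stdDensity_pos (z : EuclideanSpace ℝ (Fin k)) : 0 < stdDensity k z := by
  have := Real.pi_pos
  unfold stdDensity; positivity

@[fun_prop]
theorem continuous_stdDensity : Continuous (stdDensity k) := by
  unfold stdDensity; fun_prop

theorem integral_stdDensity : ∫ z, stdDensity k z = 1 := by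
  have := Real.pi_pos
  simp only [stdDensity]
  rw [integral_const_mul, GaussianFourier.integral_rexp_neg_mul_sq_norm (by norm_num)]
  rw [finrank_euclideanSpace_fin, ← Real.rpow_add (by positivity)]
  simp

theorem integrable_stdDensity : Integrable (stdDensity k) := by
  by_contra h
  have := integral_undef h
  rw [integral_stdDensity] at this
  exact one_ne_zero this

theorem lintegral_stdDensity : ∫⁻ z, ENNReal.ofReal (stdDensity k z) = 1 := by
  rw [← ofReal_integral_eq_lintegral_ofReal integrable_stdDensity
    (ae_of_all _ fun z => (stdDensity_pos z).le), integral_stdDensity, ENNReal.ofReal_one]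

/-- Both sides are finite measures with the same characteristic function, by the Fourier transform
of a Gaussian. -/
theorem stdGaussian_eq_withDensity :
    stdGaussian (EuclideanSpace ℝ (Fin k)) =
      volume.withDensity fun z => ENNReal.ofReal (stdDensity k z) := by
  have : IsFiniteMeasure
      (volume.withDensity fun z => ENNReal.ofReal (stdDensity k z)) :=
    isFiniteMeasure_withDensity (by rw [lintegral_stdDensity]; simp)
  refine Measure.ext_of_charFun ?_
  ext t
  rw [charFun_stdGaussian, charFun_apply,
    integral_withDensity_eq_integral_toReal_smul (by fun_prop) (by simp)]
  have hπ := Real.pi_pos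
  have h1 : ∀ z : EuclideanSpace ℝ (Fin k),
      (ENNReal.ofReal (stdDensity k z)).toReal • Complex.exp (inner ℝ z t * Complex.I) =
      ((Real.pi / (1 / 2)) ^ (-(k / 2 : ℝ)) : ℝ) *
        Complex.exp (-(1 / 2 : ℂ) * ‖z‖ ^ 2 + Complex.I * inner ℝ t z) := by
    intro z
    rw [ENNReal.toReal_ofReal (stdDensity_pos z).le, Complex.exp_add, Complex.real_smul,
      stdDensity, real_inner_comm]
    push_cast
    ring_nf
  simp_rw [h1]
  rw [integral_const_mul, GaussianFourier.integral_cexp_neg_mul_sq_norm_add (by norm_num),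
    finrank_euclideanSpace_fin, ← mul_assoc]
  have h2 : (((Real.pi / (1 / 2)) ^ (-(k / 2 : ℝ)) : ℝ) : ℂ) *
      (Real.pi / (1 / 2 : ℂ)) ^ ((k : ℂ) / 2) = 1 := by
    have : (Real.pi / (1 / 2 : ℂ)) ^ ((k : ℂ) / 2) =
        (((Real.pi / (1 / 2)) ^ (k / 2 : ℝ) : ℝ) : ℂ) := by
      rw [Complex.ofReal_cpow (by positivity)]; push_cast; rfl
    rw [this, ← Complex.ofReal_mul, ← Real.rpow_add (by positivity)]
    simp
  rw [h2, one_mul, Complex.I_sq]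
  congr 1
  ring

theorem lintegral_stdGaussian {h : EuclideanSpace ℝ (Fin k) → ℝ≥0∞} (hh : Measurable h) :
    ∫⁻ z, h z ∂(stdGaussian (EuclideanSpace ℝ (Fin k))) =
      ∫⁻ z, ENNReal.ofReal (stdDensity k z) * h z := by
  rw [stdGaussian_eq_withDensity, lintegral_withDensity_eq_lintegral_mul _ (by fun_prop) hh]
  rfl

theorem lintegral_affine {F : EuclideanSpace ℝ (Fin k) → ℝ≥0∞} (hF : Measurable F) {a : ℝ}
    (ha : 0 < a) (b : EuclideanSpace ℝ (Fin k)) :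
    ∫⁻ z, F z = ENNReal.ofReal (a ^ k) * ∫⁻ w, F (a • w + b) := by
  have h1 : ∫⁻ w, F (a • w + b) =
      ∫⁻ w, F (w + b) ∂(Measure.map (fun z : EuclideanSpace ℝ (Fin k) => a • z) volume) := by
    rw [lintegral_map (by fun_prop) (by fun_prop)]
  rw [h1, Measure.map_addHaar_smul _ ha.ne', lintegral_smul_measure,
    lintegral_add_right_eq_self, finrank_euclideanSpace_fin, smul_eq_mul, ← mul_assoc,
    ← ENNReal.ofReal_mul (by positivity), abs_of_pos (by positivity),
    mul_inv_cancel₀ (by positivity), ENNReal.ofReal_one, one_mul]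

/-- Gaussian conjugacy for a standard normal vector scaled by `√s` and observed with standard
normal noise. -/
theorem lintegral_gaussian_tilt {s : ℝ} (hs : 0 ≤ s) (y : EuclideanSpace ℝ (Fin k))
    {h : EuclideanSpace ℝ (Fin k) → ℝ≥0∞} (hh : Measurable h) :
    ∫⁻ z, ENNReal.ofReal (Real.exp (-‖y - Real.sqrt s • z‖ ^ 2 / 2)) * h (Real.sqrt s • z)
      ∂(stdGaussian (EuclideanSpace ℝ (Fin k))) =
    ENNReal.ofReal ((1 + s) ^ (-(k / 2 : ℝ)) * Real.exp (-‖y‖ ^ 2 / (2 * (1 + s)))) *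
      ∫⁻ w, h ((s / (1 + s)) • y + Real.sqrt (s / (1 + s)) • w)
        ∂(stdGaussian (EuclideanSpace ℝ (Fin k))) := by
  have hs1 : 0 < 1 + s := by linarith
  have hr1 : 0 < Real.sqrt (1 + s) := Real.sqrt_pos.2 hs1
  -- The substitution z = w / √(1 + s) + (√s / (1 + s)) y completes the square in the joint
  -- exponent; its Jacobian is the factor (1 + s)^(-k/2).
  rw [lintegral_stdGaussian (by fun_prop), lintegral_stdGaussian (by fun_prop),
    lintegral_affine (by fun_prop) (inv_pos.2 hr1) ((Real.sqrt s / (1 + s)) • y),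
    ENNReal.ofReal_mul (by positivity), mul_assoc]
  have hk : (Real.sqrt (1 + s))⁻¹ ^ k = (1 + s) ^ (-(k / 2 : ℝ)) := by
    rw [Real.sqrt_eq_rpow, ← Real.rpow_neg hs1.le, ← Real.rpow_natCast, ← Real.rpow_mul hs1.le]
    congr 1; ring
  rw [hk]
  congr 1
  rw [← lintegral_const_mul _ (by fun_prop)]
  refine lintegral_congr fun w => ?_
  have harg : Real.sqrt s • ((Real.sqrt (1 + s))⁻¹ • w + (Real.sqrt s / (1 + s)) • y) =
      (s / (1 + s)) • y + Real.sqrt (s / (1 + s)) • w := by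
    rw [smul_add, smul_smul, smul_smul, add_comm, Real.sqrt_div hs, ← mul_div_assoc,
      Real.mul_self_sqrt hs, div_eq_mul_inv (Real.sqrt s)]
  rw [harg, ← mul_assoc, ← mul_assoc, ← ENNReal.ofReal_mul (stdDensity_pos _).le,
    ← ENNReal.ofReal_mul (by positivity)]
  congr 2
  simp only [stdDensity]
  rw [mul_assoc, ← Real.exp_add, mul_left_comm, ← Real.exp_add]
  congr 2
  rw [← harg]
  have e1 := Real.sq_sqrt hs
  have e2 := Real.sq_sqrt hs1.le
  set r := Real.sqrt s
  set t := Real.sqrt (1 + s)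
  have key : ‖y - r • (t⁻¹ • w + (r / (1 + s)) • y)‖ ^ 2 + ‖t⁻¹ • w + (r / (1 + s)) • y‖ ^ 2 =
      ‖w‖ ^ 2 + ‖y‖ ^ 2 / (1 + s) := by
    rw [norm_sub_sq_real, norm_smul, mul_pow, norm_add_sq_real, inner_smul_right, inner_add_right]
    simp only [inner_smul_left, inner_smul_right, norm_smul, mul_pow, Real.norm_eq_abs, sq_abs,
      real_inner_self_eq_norm_sq, conj_trivial]
    rw [real_inner_comm y w]
    have e3 : (t⁻¹) ^ 2 = (1 + s)⁻¹ := by rw [inv_pow, e2]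
    have e4 : (r / (1 + s)) ^ 2 = s / (1 + s) ^ 2 := by rw [div_pow, e1]
    rw [e3, e4, e1]
    have e5 : r * (r / (1 + s) * ‖y‖ ^ 2) = s / (1 + s) * ‖y‖ ^ 2 := by
      rw [← mul_assoc, ← mul_div_assoc, ← sq, e1]
    rw [mul_add, e5]
    field_simp
    ring
  have : ‖y‖ ^ 2 / (2 * (1 + s)) = ‖y‖ ^ 2 / (1 + s) / 2 := by field_simp
  rw [neg_div, neg_div, this]
  linarith

/-- The density decreases with the norm. The two set differences of the balls have equal volume, and
the value of the density on the sphere of radius `R` about 0 bounds it above outside the centred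
ball and below inside. -/
theorem stdGaussian_ball_le_centered (b : EuclideanSpace ℝ (Fin k)) {R : ℝ} (hR : 0 ≤ R) :
    stdGaussian (EuclideanSpace ℝ (Fin k)) (Metric.closedBall b R) ≤
      stdGaussian (EuclideanSpace ℝ (Fin k)) (Metric.closedBall 0 R) := by
  set A := Metric.closedBall b R
  set B := Metric.closedBall (0 : EuclideanSpace ℝ (Fin k)) R
  have hA : MeasurableSet A := Metric.isClosed_closedBall.measurableSet
  have hB : MeasurableSet B := Metric.isClosed_closedBall.measurableSet
  set D := ENNReal.ofReal ((Real.pi / (1 / 2)) ^ (-(k / 2 : ℝ)) * Real.exp (-(1 / 2) * R ^ 2))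
  have hπ := Real.pi_pos
  have h1 : stdGaussian (EuclideanSpace ℝ (Fin k)) (A \ B) ≤ D * volume (A \ B) := by
    rw [stdGaussian_eq_withDensity, withDensity_apply _ (hA.diff hB), ← setLIntegral_const]
    refine setLIntegral_mono (by fun_prop) fun z hz => ENNReal.ofReal_le_ofReal ?_
    have hz2 : R < ‖z‖ := by simpa [B] using hz.2
    unfold stdDensity
    gcongr ?_ * Real.exp ?_
    nlinarith
  have h2 : D * volume (B \ A) ≤ stdGaussian (EuclideanSpace ℝ (Fin k)) (B \ A) := by
    rw [stdGaussian_eq_withDensity, withDensity_apply _ (hB.diff hA), ← setLIntegral_const]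
    refine setLIntegral_mono (by fun_prop) fun z hz => ENNReal.ofReal_le_ofReal ?_
    have hz2 : ‖z‖ ≤ R := by simpa [B] using hz.1
    unfold stdDensity
    gcongr ?_ * Real.exp ?_
    nlinarith [norm_nonneg z]
  have hv : volume (A \ B) = volume (B \ A) := by
    have e1 := measure_sdiff_add_inter (μ := volume) A hB
    have e2 := measure_sdiff_add_inter (μ := volume) B hA
    rw [Measure.addHaar_closedBall_center] at e1
    rw [← e2, inter_comm B A] at e1
    refine (ENNReal.add_left_inj (ne_top_of_le_ne_top ?_ (measure_mono inter_subset_right))).1 e1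
    exact (measure_closedBall_lt_top (x := (0 : EuclideanSpace ℝ (Fin k)))).ne
  rw [← measure_sdiff_add_inter A hB, ← measure_sdiff_add_inter B hA, inter_comm B A]
  exact add_le_add_left (h1.trans (hv ▸ h2)) _

theorem chiSq_apply {t : Set ℝ} (ht : MeasurableSet t) :
    chiSq k t = stdGaussian (EuclideanSpace ℝ (Fin k)) {z | ‖z‖ ^ 2 ∈ t} := by
  have h1 : Measurable fun z : EuclideanSpace ℝ (Fin k) => ‖z‖ ^ 2 := by fun_prop
  have h2 : Measurable fun z : Fin k → ℝ => ∑ i, z i ^ 2 := by fun_prop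
  have h3 : Measurable (WithLp.toLp 2 : (Fin k → ℝ) → EuclideanSpace ℝ (Fin k)) := by fun_prop
  have h4 : MeasurableSet {z : EuclideanSpace ℝ (Fin k) | ‖z‖ ^ 2 ∈ t} := h1 ht
  rw [chiSq, ← map_pi_eq_stdGaussian, Measure.map_apply h2 ht, Measure.map_apply h3 h4]
  congr 1
  ext z
  simp [EuclideanSpace.real_norm_sq_eq]

instance : IsProbabilityMeasure (chiSq k) :=
  Measure.isProbabilityMeasure_map
    (Measurable.aemeasurable (f := fun z : Fin k → ℝ => ∑ i, z i ^ 2) (by fun_prop))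

theorem chiSq_Iio_zero : chiSq k (Iio 0) = 0 := by
  rw [chiSq_apply measurableSet_Iio]
  convert measure_empty (μ := stdGaussian (EuclideanSpace ℝ (Fin k)))
  ext z
  simp

theorem stdGaussian_singleton (hk : 0 < k) (b : EuclideanSpace ℝ (Fin k)) :
    stdGaussian (EuclideanSpace ℝ (Fin k)) {b} = 0 := by
  have : Nonempty (Fin k) := ⟨⟨0, hk⟩⟩
  rw [stdGaussian_eq_withDensity]
  exact withDensity_absolutelyContinuous _ _ (measure_singleton b)

end StdGaussian

/-! ### One-dimensional integrals and the Lomax prior of the scale. -/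

theorem exp_neg_le_rpow {p y : ℝ} (hp : 0 < p) (hy : 0 < y) :
    Real.exp (-y) ≤ p ^ p * y ^ (-p) := by
  have h1 : y / p ≤ Real.exp (y / p) := by linarith [Real.add_one_le_exp (y / p)]
  have h2 : Real.exp (-y) = Real.exp (y / p) ^ (-p) := by
    rw [← Real.exp_mul]; congr 1; field_simp
  have h3 : p ^ p * y ^ (-p) = (y / p) ^ (-p) := by
    rw [Real.div_rpow hy.le hp.le, Real.rpow_neg hp.le p, div_inv_eq_mul, mul_comm]
  rw [h2, h3]
  exact Real.rpow_le_rpow_of_nonpos (by positivity) h1 (by linarith)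

theorem setLIntegral_Ioi_scale {G : ℝ → ℝ≥0∞} (hG : Measurable G) {a : ℝ} (ha : 0 < a) :
    ∫⁻ s in Ioi 0, G s = ENNReal.ofReal a * ∫⁻ l in Ioi 0, G (l * a) := by
  rw [← lintegral_indicator measurableSet_Ioi, ← lintegral_indicator measurableSet_Ioi]
  conv_lhs => rw [← Real.smul_map_volume_mul_right ha.ne']
  rw [lintegral_smul_measure, lintegral_map (hG.indicator measurableSet_Ioi) (by fun_prop),
    abs_of_pos ha, smul_eq_mul]
  congr 1
  refine lintegral_congr fun l => ?_
  by_cases hl : 0 < l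
  · rw [indicator_of_mem (show l * a ∈ Ioi 0 from mul_pos hl ha), indicator_of_mem (mem_Ioi.2 hl)]
  · have hl2 : l * a ∉ Ioi 0 := fun h => hl (pos_of_mul_pos_left h ha.le)
    rw [indicator_of_notMem hl2, indicator_of_notMem (show l ∉ Ioi 0 from hl)]

theorem setLIntegral_Ioi_rpow_ne_top {p a : ℝ} (hp : p < -1) (ha : 0 < a) :
    ∫⁻ v in Ioi a, ENNReal.ofReal (v ^ p) ≠ ∞ := by
  have h := (integrableOn_Ioi_rpow_of_lt hp ha).lintegral_lt_top
  exact h.ne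

/-- Near 0 the exponential cancels the power, leaving a bounded integrand; beyond 1 the power alone
is integrable. -/
theorem lintegral_exp_neg_inv_mul_rpow_ne_top {a p : ℝ} (ha : 0 < a) (hp : 1 < p) :
    ∫⁻ v in Ioi 0, ENNReal.ofReal (Real.exp (-a / (2 * v)) * v ^ (-p)) ≠ ∞ := by
  have hp0 : 0 < p := by linarith
  rw [← Ioc_union_Ioi_eq_Ioi zero_le_one,
    lintegral_union measurableSet_Ioi (Set.Ioc_disjoint_Ioi le_rfl)]
  refine ENNReal.add_ne_top.2 ⟨?_, ?_⟩
  · have h : ∫⁻ v in Ioc (0 : ℝ) 1, ENNReal.ofReal (Real.exp (-a / (2 * v)) * v ^ (-p)) ≤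
        ∫⁻ v in Ioc (0 : ℝ) 1, ENNReal.ofReal (p ^ p * (a / 2) ^ (-p)) := by
      refine setLIntegral_mono measurable_const fun v hv => ENNReal.ofReal_le_ofReal ?_
      have hv0 : 0 < v := hv.1
      have h1 := exp_neg_le_rpow hp0 (show 0 < a / (2 * v) by positivity)
      have h2 : (a / (2 * v)) ^ (-p) * v ^ (-p) = (a / 2) ^ (-p) := by
        rw [← Real.mul_rpow (by positivity) hv0.le]; congr 1; field_simp
      calc Real.exp (-a / (2 * v)) * v ^ (-p) ≤ p ^ p * (a / (2 * v)) ^ (-p) * v ^ (-p) := by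
            rw [neg_div]; gcongr
        _ = _ := by rw [mul_assoc, h2]
    refine ne_top_of_le_ne_top ?_ h
    rw [setLIntegral_const]
    exact ENNReal.mul_ne_top ENNReal.ofReal_ne_top (by simp)
  · refine ne_top_of_le_ne_top (setLIntegral_Ioi_rpow_ne_top (p := -p) (by linarith) one_pos)
      (setLIntegral_mono (by fun_prop) fun v hv => ENNReal.ofReal_le_ofReal ?_)
    have hv0 : 0 < v := one_pos.trans hv
    refine mul_le_of_le_one_left (by positivity) (Real.exp_le_one_iff.2 ?_)
    rw [neg_div]; exact neg_nonpos.2 (by positivity)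

theorem setLIntegral_Ioi_ne_zero {g : ℝ → ℝ} (hg : Measurable g) (hpos : ∀ v, 0 < v → 0 < g v) :
    ∫⁻ v in Ioi 0, ENNReal.ofReal (g v) ≠ 0 := by
  intro h
  rw [setLIntegral_eq_zero_iff measurableSet_Ioi (by fun_prop)] at h
  have h2 : ∀ᵐ v ∂(volume.restrict (Ioi (0 : ℝ))), False := by
    rw [ae_restrict_iff' measurableSet_Ioi]
    filter_upwards [h] with v hv hv0
    exact (ENNReal.ofReal_pos.2 (hpos v hv0)).ne' (hv hv0)
  have h3 : volume.restrict (Ioi (0 : ℝ)) = 0 := ae_eq_bot.1 (eventually_false_iff_eq_bot.1 h2)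
  rw [Measure.restrict_eq_zero] at h3
  simp at h3

theorem lintegral_expMeasure {h : ℝ → ℝ≥0∞} (hh : Measurable h) :
    ∫⁻ l, h l ∂(expMeasure (1 / 2)) =
      ∫⁻ l in Ioi 0, ENNReal.ofReal (1 / 2 * Real.exp (-(1 / 2 * l))) * h l := by
  have hm : Measurable (gammaPDF 1 (1 / 2)) := (measurable_gammaPDFReal 1 (1 / 2)).ennreal_ofReal
  rw [expMeasure, gammaMeasure, lintegral_withDensity_eq_lintegral_mul _ hm hh,
    ← lintegral_indicator measurableSet_Ioi]
  refine lintegral_congr_ae ?_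
  filter_upwards [measure_eq_zero_iff_ae_notMem.1 (measure_singleton (μ := volume) (0 : ℝ))]
    with l hl
  have hl0 : l ≠ 0 := hl
  change exponentialPDF (1 / 2) l * h l = _
  rw [exponentialPDF_eq]
  rcases lt_or_gt_of_ne hl0 with h1 | h1
  · rw [if_neg (not_le.2 h1), indicator_of_notMem (by simp [h1.le])]; simp
  · rw [if_pos h1.le, indicator_of_mem (mem_Ioi.2 h1)]

/-- Under the prior, the product of the two scale parameters has a Lomax law. -/
theorem lintegral_scalePrior {d c : ℝ} (hd : 0 < d) (hc : 0 < c) :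
    ∃ C : ℝ≥0∞, C ≠ 0 ∧ C ≠ ∞ ∧ ∀ h : ℝ → ℝ≥0∞, Measurable h →
      ∫⁻ p, h (p.1 * p.2) ∂(scalePrior d c) =
        C * ∫⁻ s in Ioi 0, ENNReal.ofReal ((c + s) ^ (-d - 1)) * h s := by
  set Z := ∫⁻ v in Ioi (0 : ℝ), ENNReal.ofReal (Real.exp (-c / (2 * v)) * v ^ (-d - 1)) with hZ
  set J := ∫⁻ v in Ioi (0 : ℝ),
    ENNReal.ofReal (1 / 2 * (Real.exp (-1 / (2 * v)) * v ^ (-d - 2))) with hJ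
  have hZ0 : Z ≠ 0 := setLIntegral_Ioi_ne_zero (by fun_prop) fun v hv => by positivity
  have hJ0 : J ≠ 0 := setLIntegral_Ioi_ne_zero (by fun_prop) fun v hv => by positivity
  have hZt : Z ≠ ∞ := by
    have := lintegral_exp_neg_inv_mul_rpow_ne_top hc (show 1 < d + 1 by linarith)
    rwa [neg_add, ← sub_eq_add_neg] at this
  have hJt : J ≠ ∞ := by
    have := lintegral_exp_neg_inv_mul_rpow_ne_top one_pos (show 1 < d + 2 by linarith)
    rw [neg_add, ← sub_eq_add_neg] at this
    simp_rw [hJ, ENNReal.ofReal_mul (show (0 : ℝ) ≤ 1 / 2 by norm_num)]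
    rw [lintegral_const_mul _ (by fun_prop)]
    exact ENNReal.mul_ne_top ENNReal.ofReal_ne_top this
  refine ⟨Z⁻¹ * J, by simp [hZt, hJ0], ENNReal.mul_ne_top (ENNReal.inv_ne_top.2 hZ0) hJt,
    fun h hh => ?_⟩
  have := isProbabilityMeasure_expMeasure (r := 1 / 2) (by norm_num)
  have hmeas : Measurable fun p : ℝ × ℝ => h (p.1 * p.2) := by fun_prop
  have hinner : Measurable fun t : ℝ => ∫⁻ l, h (l * t) ∂(expMeasure (1 / 2)) :=
    hmeas.lintegral_prod_left'
  have hmass : ((volume.restrict (Ioi 0)).withDensity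
      fun t => ENNReal.ofReal (Real.exp (-c / (2 * t)) * t ^ (-d - 1))) univ = Z := by
    rw [withDensity_apply _ MeasurableSet.univ, Measure.restrict_univ]
  rw [scalePrior, lintegral_prod_symm _ hmeas.aemeasurable, invGammaPrior, normalized, hmass,
    lintegral_smul_measure, smul_eq_mul, mul_assoc,
    lintegral_withDensity_eq_lintegral_mul _ (by fun_prop) hinner]
  congr 1
  -- For fixed t the substitution s = l t merges the two exponentials into exp(-(c + s) / (2t)) and
  -- costs a factor 1/t.
  have hscale : ∀ t ∈ Ioi (0 : ℝ),
      (fun t => ENNReal.ofReal (Real.exp (-c / (2 * t)) * t ^ (-d - 1))) t *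
        ∫⁻ l, h (l * t) ∂(expMeasure (1 / 2)) =
      ∫⁻ s in Ioi 0, ENNReal.ofReal (1 / 2 * (Real.exp (-(c + s) / (2 * t)) * t ^ (-d - 2))) *
        h s := by
    intro t ht
    have ht0 : 0 < t := ht
    rw [lintegral_expMeasure (by fun_prop), ← lintegral_const_mul _ (by fun_prop)]
    conv_rhs => rw [setLIntegral_Ioi_scale (by fun_prop) ht0, ← lintegral_const_mul _ (by fun_prop)]
    refine setLIntegral_congr_fun measurableSet_Ioi fun l hl => ?_
    have hl0 : 0 < l := hl
    simp only
    rw [← mul_assoc, ← mul_assoc, ← ENNReal.ofReal_mul (by positivity),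
      ← ENNReal.ofReal_mul (by positivity)]
    congr 2
    have e1 : t ^ (-d - 2) = t ^ (-d - 1) / t := by
      rw [show -d - 2 = -d - 1 - 1 by ring, Real.rpow_sub_one ht0.ne']
    have e2 : -(c + l * t) / (2 * t) = -c / (2 * t) + -(1 / 2 * l) := by field_simp; ring
    rw [e1, e2, Real.exp_add]
    field_simp
  refine (setLIntegral_congr_fun measurableSet_Ioi hscale).trans ?_
  rw [lintegral_lintegral_swap (by fun_prop),
    ← lintegral_const_mul _ (by fun_prop)]
  refine setLIntegral_congr_fun measurableSet_Ioi fun s hs => ?_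
  have hs0 : 0 < s := hs
  have hcs : 0 < c + s := by linarith
  rw [lintegral_mul_const _ (by fun_prop), ← mul_assoc]
  congr 1
  -- Substituting t = v (c + s) frees the exponential of s: the power (c + s)^(-d-1) factors out and
  -- the constant `J` remains.
  rw [setLIntegral_Ioi_scale (by fun_prop) hcs, mul_comm J, hJ, ← lintegral_const_mul _ (by fun_prop),
    ← lintegral_const_mul _ (by fun_prop)]
  refine setLIntegral_congr_fun measurableSet_Ioi fun v hv => ?_
  have hv0 : 0 < v := hv
  rw [← ENNReal.ofReal_mul hcs.le, ← ENNReal.ofReal_mul (by positivity)]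
  congr 1
  have e1 : -(c + s) / (2 * (v * (c + s))) = -1 / (2 * v) := by field_simp
  have e2 : (c + s) ^ (-d - 2) = (c + s) ^ (-d - 1) / (c + s) := by
    rw [show -d - 2 = -d - 1 - 1 by ring, Real.rpow_sub_one hcs.ne']
  rw [e1, Real.mul_rpow hv0.le hcs.le, e2]
  field_simp

/-! ### Normalization of measures. -/

section Normalized

variable {Ω Ω' : Type*} [MeasurableSpace Ω] [MeasurableSpace Ω']

theorem normalized_smul {μ : Measure Ω} {C : ℝ≥0∞} (h0 : C ≠ 0) (ht : C ≠ ∞) :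
    normalized (C • μ) = normalized μ := by
  rw [normalized, normalized, Measure.smul_apply, smul_smul, smul_eq_mul,
    ENNReal.mul_inv (Or.inl h0) (Or.inl ht), mul_assoc, mul_comm _ C, ← mul_assoc,
    ENNReal.inv_mul_cancel h0 ht, one_mul]

theorem normalized_map_prod {μ : Measure Ω} [SFinite μ] {γ : Measure Ω'} [IsProbabilityMeasure γ]
    {Ω'' : Type*} [MeasurableSpace Ω''] {Φ : Ω × Ω' → Ω''} (hΦ : Measurable Φ) :
    normalized ((μ.prod γ).map Φ) = ((normalized μ).prod γ).map Φ := by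
  have h : ((μ.prod γ).map Φ) univ = μ univ := by
    rw [Measure.map_apply hΦ MeasurableSet.univ, preimage_univ, ← univ_prod_univ,
      Measure.prod_prod, measure_univ (μ := γ), mul_one]
  rw [normalized, normalized, h, Measure.prod_smul_left, Measure.map_smul]

theorem isProbabilityMeasure_normalized {μ : Measure Ω} (h0 : μ univ ≠ 0) (ht : μ univ ≠ ∞) :
    IsProbabilityMeasure (normalized μ) :=
  ⟨by rw [normalized, Measure.smul_apply, smul_eq_mul, ENNReal.inv_mul_cancel h0 ht]⟩

end Normalized

/-! ### Posterior law of the scale. -/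

/-- The shrinkage factor of a scale. -/
noncomputable def shrink (s : ℝ) : ℝ := s / (1 + s)

theorem shrink_nonneg {s : ℝ} (hs : 0 ≤ s) : 0 ≤ shrink s := by unfold shrink; positivity

theorem shrink_le_one {s : ℝ} (hs : 0 ≤ s) : shrink s ≤ 1 := by
  unfold shrink; rw [div_le_one (by linarith)]; linarith

@[fun_prop]
theorem measurable_shrink : Measurable shrink := by unfold shrink; fun_prop

/-- The unnormalized posterior density of the scale `λ² τ`, when the observation has squared
Mahalanobis norm `u`. -/
noncomputable def scaleWeight (k : ℕ) (d c u s : ℝ) : ℝ :=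
  (c + s) ^ (-d - 1) * ((1 + s) ^ (-(k / 2 : ℝ)) * Real.exp (-u / (2 * (1 + s))))

@[fun_prop]
theorem measurable_scaleWeight {k : ℕ} {d c u : ℝ} : Measurable (scaleWeight k d c u) := by
  unfold scaleWeight; fun_prop

theorem scaleWeight_pos {k : ℕ} {d c u s : ℝ} (hc : 0 < c) (hs : 0 < s) :
    0 < scaleWeight k d c u s := by
  unfold scaleWeight; positivity

theorem scaleWeight_le {k : ℕ} {d c u s : ℝ} (hc : 0 < c) (hu : 0 ≤ u) (hs : 0 < s) :
    scaleWeight k d c u s ≤ (c + s) ^ (-d - 1) := by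
  unfold scaleWeight
  refine mul_le_of_le_one_right (by positivity) (mul_le_one₀ ?_ (by positivity) ?_)
  · exact Real.rpow_le_one_of_one_le_of_nonpos (by linarith) (neg_nonpos.2 (by positivity))
  · rw [Real.exp_le_one_iff, neg_div]; exact neg_nonpos.2 (by positivity)

/-- The posterior law of the scale. -/
noncomputable def scalePosterior (k : ℕ) (d c u : ℝ) : Measure ℝ :=
  normalized ((volume.restrict (Ioi 0)).withDensity
    fun s => ENNReal.ofReal (scaleWeight k d c u s))

/-- The total mass of the unnormalized posterior density of the scale. -/
noncomputable def scaleMass (k : ℕ) (d c u : ℝ) : ℝ≥0∞ :=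
  ∫⁻ s in Ioi 0, ENNReal.ofReal (scaleWeight k d c u s)

theorem scaleMass_ne_zero {k : ℕ} {d c u : ℝ} (hc : 0 < c) : scaleMass k d c u ≠ 0 :=
  setLIntegral_Ioi_ne_zero (by fun_prop) fun _ hs => scaleWeight_pos hc hs

theorem scaleMass_ne_top {k : ℕ} {d c u : ℝ} (hd : 0 < d) (hc : 0 < c) (hu : 0 ≤ u) :
    scaleMass k d c u ≠ ∞ := by
  rw [scaleMass, ← Ioc_union_Ioi_eq_Ioi zero_le_one,
    lintegral_union measurableSet_Ioi (Set.Ioc_disjoint_Ioi le_rfl)]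
  refine ENNReal.add_ne_top.2 ⟨?_, ?_⟩
  · refine ne_top_of_le_ne_top ?_ (setLIntegral_mono (measurable_const (a :=
      ENNReal.ofReal (c ^ (-d - 1)))) fun s hs => ENNReal.ofReal_le_ofReal ?_)
    · rw [setLIntegral_const]
      exact ENNReal.mul_ne_top ENNReal.ofReal_ne_top (by simp)
    · exact (scaleWeight_le hc hu hs.1).trans
        (Real.rpow_le_rpow_of_nonpos hc (by linarith [hs.1]) (by linarith))
  · refine ne_top_of_le_ne_top (setLIntegral_Ioi_rpow_ne_top (p := -d - 1) (by linarith) one_pos)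
      (setLIntegral_mono (by fun_prop) fun s hs => ENNReal.ofReal_le_ofReal ?_)
    have hs0 : 0 < s := one_pos.trans hs
    exact (scaleWeight_le hc hu hs0).trans
      (Real.rpow_le_rpow_of_nonpos hs0 (by linarith) (by linarith))

theorem scaleMeasure_univ {k : ℕ} {d c u : ℝ} :
    ((volume.restrict (Ioi 0)).withDensity
      fun s => ENNReal.ofReal (scaleWeight k d c u s)) univ = scaleMass k d c u := by
  rw [withDensity_apply _ MeasurableSet.univ, Measure.restrict_univ, scaleMass]

theorem isProbabilityMeasure_scalePosterior {k : ℕ} {d c u : ℝ} (hd : 0 < d) (hc : 0 < c)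
    (hu : 0 ≤ u) : IsProbabilityMeasure (scalePosterior k d c u) :=
  isProbabilityMeasure_normalized (by rw [scaleMeasure_univ]; exact scaleMass_ne_zero hc)
    (by rw [scaleMeasure_univ]; exact scaleMass_ne_top hd hc hu)

theorem lintegral_scalePosterior {k : ℕ} {d c u : ℝ} {h : ℝ → ℝ≥0∞} (hh : Measurable h) :
    ∫⁻ s, h s ∂(scalePosterior k d c u) =
      (scaleMass k d c u)⁻¹ *
        ∫⁻ s in Ioi 0, ENNReal.ofReal (scaleWeight k d c u s) * h s := by
  rw [scalePosterior, normalized, scaleMeasure_univ, lintegral_smul_measure, smul_eq_mul,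
    lintegral_withDensity_eq_lintegral_mul _ (by fun_prop) hh]
  rfl

theorem ae_pos_scalePosterior {k : ℕ} {d c u : ℝ} : ∀ᵐ s ∂(scalePosterior k d c u), 0 < s := by
  refine Measure.ae_smul_measure ?_ _
  refine (withDensity_absolutelyContinuous _ _).ae_le ?_
  filter_upwards [ae_restrict_mem measurableSet_Ioi] with t ht using ht

/-! ### Whitening and the mixture form of the posterior. -/

section Whitening

open scoped MatrixOrder

variable {k : ℕ} {V : Matrix (Fin k) (Fin k) ℝ}

/-- The square root of the covariance matrix, as a linear map. -/
noncomputable def sqrtMap (V : Matrix (Fin k) (Fin k) ℝ) :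
    EuclideanSpace ℝ (Fin k) →L[ℝ] EuclideanSpace ℝ (Fin k) :=
  toEuclideanCLM (𝕜 := ℝ) (CFC.sqrt V)

theorem sqrt_mul_inv_mul_sqrt (hV : V.PosDef) : CFC.sqrt V * V⁻¹ * CFC.sqrt V = 1 := by
  have h : CFC.sqrt V * CFC.sqrt V = V := CFC.sqrt_mul_sqrt_self V hV.posSemidef.nonneg
  have hdet : IsUnit (CFC.sqrt V).det := by
    have h2 : IsUnit V.det := hV.det_pos.ne'.isUnit
    rw [← h, det_mul] at h2
    exact isUnit_of_mul_isUnit_left h2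
  have hi : V⁻¹ = (CFC.sqrt V)⁻¹ * (CFC.sqrt V)⁻¹ := by rw [← Matrix.mul_inv_rev, h]
  rw [hi, ← mul_assoc, Matrix.mul_nonsing_inv _ hdet, one_mul, Matrix.nonsing_inv_mul _ hdet]

theorem isUnit_det_sqrt (hV : V.PosDef) : IsUnit (CFC.sqrt V).det := by
  have h2 := congrArg Matrix.det (sqrt_mul_inv_mul_sqrt hV)
  rw [det_mul, det_one] at h2
  exact IsUnit.of_mul_eq_one_right _ h2

theorem mahalSq_sqrtMap (hV : V.PosDef) (z : EuclideanSpace ℝ (Fin k)) :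
    mahalSq V (sqrtMap V z) = ‖z‖ ^ 2 := by
  have hsymm : (CFC.sqrt V)ᵀ = CFC.sqrt V := by
    have : (CFC.sqrt V).IsHermitian := (Matrix.nonneg_iff_posSemidef.1 (CFC.sqrt_nonneg V)).1
    rwa [Matrix.IsHermitian, conjTranspose_eq_transpose_of_trivial] at this
  have h1 : (sqrtMap V z).ofLp = CFC.sqrt V *ᵥ z.ofLp := by
    rw [sqrtMap, Matrix.ofLp_toEuclideanCLM]
  rw [mahalSq, h1, mulVec_mulVec]
  conv_lhs => rw [← hsymm]
  rw [mulVec_transpose, ← dotProduct_mulVec, mulVec_mulVec, hsymm, ← mul_assoc,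
    sqrt_mul_inv_mul_sqrt hV, one_mulVec, EuclideanSpace.real_norm_sq_eq, dotProduct]
  simp [sq]

theorem sqrtMap_surjective (hV : V.PosDef) (x : EuclideanSpace ℝ (Fin k)) :
    ∃ y, sqrtMap V y = x := by
  refine ⟨WithLp.toLp 2 ((CFC.sqrt V)⁻¹ *ᵥ x.ofLp), ?_⟩
  ext i
  rw [sqrtMap, Matrix.ofLp_toEuclideanCLM, mulVec_mulVec,
    Matrix.mul_nonsing_inv _ (isUnit_det_sqrt hV), one_mulVec]

theorem measurable_mahalSq : Measurable (mahalSq V) := by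
  have : Continuous (mahalSq V) := by unfold mahalSq; fun_prop
  exact this.measurable

theorem lintegral_meanPrior (hV : V.PosDef) {d c : ℝ} (hd : 0 < d) (hc : 0 < c) :
    ∃ C : ℝ≥0∞, C ≠ 0 ∧ C ≠ ∞ ∧ ∀ g : EuclideanSpace ℝ (Fin k) → ℝ≥0∞, Measurable g →
      ∫⁻ θ, g θ ∂(meanPrior V d c) =
        C * ∫⁻ s in Ioi 0, ENNReal.ofReal ((c + s) ^ (-d - 1)) *
          ∫⁻ z, g (sqrtMap V (Real.sqrt s • z)) ∂(stdGaussian (EuclideanSpace ℝ (Fin k))) := by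
  obtain ⟨C, h0, ht, hC⟩ := lintegral_scalePrior hd hc
  refine ⟨C, h0, ht, fun g hg => ?_⟩
  have hm : Measurable fun q : ℝ × EuclideanSpace ℝ (Fin k) =>
      g (sqrtMap V (Real.sqrt q.1 • q.2)) := by fun_prop
  rw [← hC _ hm.lintegral_prod_right', meanPrior,
    Measure.lintegral_bind (aemeasurable_kernel hV.posSemidef d c) hg.aemeasurable]
  refine lintegral_congr_ae ?_
  filter_upwards [ae_pos d c] with p hp
  rw [gauss_smul hV.posSemidef hp, lintegral_map hg (by fun_prop), multivariateGaussian,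
    lintegral_map (by fun_prop) (by fun_prop)]
  simp [sqrtMap]

/-- The posterior law is the law of a normal vector with a random scale. -/
theorem posterior_eq_map (hV : V.PosDef) {d c : ℝ} (hd : 0 < d) (hc : 0 < c)
    (y : EuclideanSpace ℝ (Fin k)) :
    posterior V d c (sqrtMap V y) =
      ((scalePosterior k d c (‖y‖ ^ 2)).prod (stdGaussian (EuclideanSpace ℝ (Fin k)))).map
        fun q => sqrtMap V (shrink q.1 • y + Real.sqrt (shrink q.1) • q.2) := by
  obtain ⟨C, h0, ht, hC⟩ := lintegral_meanPrior hV hd hc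
  have hΦ : Measurable fun q : ℝ × EuclideanSpace ℝ (Fin k) =>
      sqrtMap V (shrink q.1 • y + Real.sqrt (shrink q.1) • q.2) := by fun_prop
  have hmah : Measurable (mahalSq V) := measurable_mahalSq
  rw [scalePosterior, ← normalized_map_prod hΦ, posterior]
  -- The unknown constant `C` of the Lomax prior disappears under normalization.
  refine Eq.trans ?_ (normalized_smul h0 ht)
  congr 1
  ext A hA
  have hlik : Measurable fun θ : EuclideanSpace ℝ (Fin k) =>
      ENNReal.ofReal (Real.exp (-mahalSq V (sqrtMap V y - θ) / 2)) := by fun_prop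
  have hind : Measurable (A.indicator (1 : EuclideanSpace ℝ (Fin k) → ℝ≥0∞)) :=
    measurable_one.indicator hA
  rw [← lintegral_indicator_one hA, lintegral_withDensity_eq_lintegral_mul _ hlik hind,
    hC _ (hlik.mul hind), Measure.smul_apply, smul_eq_mul, ← lintegral_indicator_one hA,
    lintegral_map hind hΦ, lintegral_prod _ (by fun_prop)]
  have hm : Measurable fun q : ℝ × EuclideanSpace ℝ (Fin k) =>
      A.indicator (1 : EuclideanSpace ℝ (Fin k) → ℝ≥0∞)
        (sqrtMap V (shrink q.1 • y + Real.sqrt (shrink q.1) • q.2)) := by fun_prop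
  rw [lintegral_withDensity_eq_lintegral_mul _ (by fun_prop) hm.lintegral_prod_right']
  congr 1
  refine setLIntegral_congr_fun measurableSet_Ioi fun s hs => ?_
  have hs0 : 0 < s := hs
  simp only [Pi.mul_apply]
  -- Conjugacy at fixed s: the prefactor is the marginal likelihood entering `scaleWeight`, and the
  -- remaining integral is the conditional normal law.
  have h1 := lintegral_gaussian_tilt hs0.le y
    (h := fun v => A.indicator (1 : EuclideanSpace ℝ (Fin k) → ℝ≥0∞) (sqrtMap V v)) (by fun_prop)
  simp_rw [← map_sub, mahalSq_sqrtMap hV]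
  rw [h1, ← mul_assoc, ← ENNReal.ofReal_mul (by positivity)]
  rfl

end Whitening

/-! ### Estimates for the posterior law of the scale. -/

theorem setLIntegral_Ioc_rpow_ne_top {r a : ℝ} (hr : -1 < r) (ha : 0 ≤ a) :
    ∫⁻ v in Ioc 0 a, ENNReal.ofReal (v ^ r) ≠ ∞ := by
  have h := intervalIntegral.intervalIntegrable_rpow' (a := 0) (b := a) hr
  rw [intervalIntegrable_iff_integrableOn_Ioc_of_le ha] at h
  exact h.lintegral_lt_top.ne

theorem ofReal_mul_sub_le_setLIntegral {g : ℝ → ℝ} (hg : Measurable g) {p q m : ℝ} (hp : 0 ≤ p)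
    (hm : ∀ s ∈ Ioc p q, m ≤ g s) (hm0 : 0 ≤ m) :
    ENNReal.ofReal (m * (q - p)) ≤ ∫⁻ s in Ioi 0, ENNReal.ofReal (g s) :=
  calc ENNReal.ofReal (m * (q - p)) = ∫⁻ _ in Ioc p q, ENNReal.ofReal m := by
        rw [setLIntegral_const, Real.volume_Ioc, ENNReal.ofReal_mul hm0]
    _ ≤ ∫⁻ s in Ioc p q, ENNReal.ofReal (g s) :=
        setLIntegral_mono (by fun_prop) fun s hs => ENNReal.ofReal_le_ofReal (hm s hs)
    _ ≤ _ := lintegral_mono_set fun s hs => hp.trans_lt hs.1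

theorem inv_le_ofReal_of_ofReal_le {M : ℝ≥0∞} {a b : ℝ} (ha : 0 < a) (hab : a * b = 1)
    (h : ENNReal.ofReal a ≤ M) : M⁻¹ ≤ ENNReal.ofReal b := by
  rw [eq_inv_of_mul_eq_one_right hab, ENNReal.ofReal_inv_of_pos ha]
  exact ENNReal.inv_le_inv.2 h

/-- The interval (0, c] alone carries mass of order c^(-d) e^(-u/2): there c + s ≤ 2c, 1 + s ≤ 2,
and the exponential is smallest at s = 0. -/
theorem inv_scaleMass_le {k : ℕ} {d c u : ℝ} (hd : 0 < d) (hc : 0 < c) (hc1 : c ≤ 1)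
    (hu : 0 ≤ u) :
    (scaleMass k d c u)⁻¹ ≤
      ENNReal.ofReal (2 ^ (d + 1) * 2 ^ (k / 2 : ℝ) * c ^ d * Real.exp (u / 2)) := by
  set m := (2 * c) ^ (-d - 1) * (2 ^ (-(k / 2 : ℝ)) * Real.exp (-u / 2))
  refine inv_le_ofReal_of_ofReal_le (a := m * (c - 0)) (by simp only [m, sub_zero]; positivity) ?_ ?_
  · have h1 : (2 * c) ^ (-d - 1) * c * (2 ^ (d + 1) * c ^ d) = 1 := by
      rw [Real.mul_rpow (by norm_num) hc.le]
      have e1 : (2 : ℝ) ^ (-d - 1) * 2 ^ (d + 1) = 1 := by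
        rw [← Real.rpow_add (by norm_num)]; simp
      have e2 : c ^ (-d - 1) * c * c ^ d = 1 := by
        rw [← Real.rpow_add_one hc.ne', ← Real.rpow_add hc]; simp
      linear_combination c ^ (-d - 1) * c * c ^ d * e1 + e2
    have h2 : (2 : ℝ) ^ (-(k / 2 : ℝ)) * 2 ^ (k / 2 : ℝ) = 1 := by
      rw [← Real.rpow_add (by norm_num)]; simp
    have h3 : Real.exp (-u / 2) * Real.exp (u / 2) = 1 := by
      rw [← Real.exp_add, neg_div]; simp
    calc m * (c - 0) * (2 ^ (d + 1) * 2 ^ (k / 2 : ℝ) * c ^ d * Real.exp (u / 2))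
        = ((2 * c) ^ (-d - 1) * c * (2 ^ (d + 1) * c ^ d)) *
          ((2 : ℝ) ^ (-(k / 2 : ℝ)) * 2 ^ (k / 2 : ℝ)) *
          (Real.exp (-u / 2) * Real.exp (u / 2)) := by simp only [m]; ring
      _ = 1 := by rw [h1, h2, h3]; norm_num
  · refine ofReal_mul_sub_le_setLIntegral (by fun_prop) le_rfl (fun s hs => ?_) (by positivity)
    have hs0 : 0 < s := hs.1
    have hsc : s ≤ c := hs.2
    unfold scaleWeight
    refine mul_le_mul ?_ (mul_le_mul ?_ ?_ (by positivity) (by positivity)) (by positivity)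
      (by positivity)
    · exact Real.rpow_le_rpow_of_nonpos (by linarith) (by linarith) (by linarith)
    · exact Real.rpow_le_rpow_of_nonpos (by linarith) (by linarith)
        (neg_nonpos.2 (by positivity))
    · rw [Real.exp_le_exp, neg_div, neg_div, neg_le_neg_iff]
      exact div_le_div_of_nonneg_left hu (by norm_num) (by linarith)

/-- The factor κ makes the numerator bounded uniformly in `c` and `u`: the integrand is at most
s^(-d) / (1 + s), integrable precisely because 0 < d < 1. The whole bound therefore comes from
`inv_scaleMass_le`. -/
theorem lintegral_shrink_le (k : ℕ) {d : ℝ} (hd : 0 < d) (hd1 : d < 1) :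
    ∃ B : ℝ, 0 < B ∧ ∀ c u : ℝ, 0 < c → c ≤ 1 → 0 ≤ u →
      ∫⁻ s, ENNReal.ofReal (shrink s) ∂(scalePosterior k d c u) ≤
        ENNReal.ofReal (B * c ^ d * Real.exp (u / 2)) := by
  set I := ∫⁻ s in Ioi (0 : ℝ), ENNReal.ofReal (s ^ (-d) / (1 + s)) with hI
  have hIt : I ≠ ∞ := by
    rw [hI, ← Ioc_union_Ioi_eq_Ioi zero_le_one,
      lintegral_union measurableSet_Ioi (Set.Ioc_disjoint_Ioi le_rfl)]
    refine ENNReal.add_ne_top.2 ⟨?_, ?_⟩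
    · refine ne_top_of_le_ne_top (setLIntegral_Ioc_rpow_ne_top (r := -d) (by linarith) zero_le_one)
        (setLIntegral_mono (by fun_prop) fun s hs => ENNReal.ofReal_le_ofReal ?_)
      have hs0 : 0 < s := hs.1
      exact div_le_self (by positivity) (by linarith)
    · refine ne_top_of_le_ne_top (setLIntegral_Ioi_rpow_ne_top (p := -d - 1) (by linarith) one_pos)
        (setLIntegral_mono (by fun_prop) fun s hs => ENNReal.ofReal_le_ofReal ?_)
      have hs0 : 0 < s := one_pos.trans hs
      rw [Real.rpow_sub_one hs0.ne']
      exact div_le_div_of_nonneg_left (by positivity) hs0 (by linarith)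
  refine ⟨2 ^ (d + 1) * 2 ^ (k / 2 : ℝ) * (I.toReal + 1), by positivity,
    fun c u hc hc1 hu => ?_⟩
  rw [lintegral_scalePosterior (by fun_prop)]
  have hnum : ∫⁻ s in Ioi 0, ENNReal.ofReal (scaleWeight k d c u s) * ENNReal.ofReal (shrink s) ≤
      ENNReal.ofReal (I.toReal + 1) := by
    refine le_trans (b := I) ?_ ?_
    · refine setLIntegral_mono (by fun_prop) fun s hs => ?_
      have hs0 : 0 < s := hs
      rw [← ENNReal.ofReal_mul (scaleWeight_pos hc hs0).le]
      refine ENNReal.ofReal_le_ofReal ?_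
      calc scaleWeight k d c u s * shrink s ≤ s ^ (-d - 1) * shrink s := by
            refine mul_le_mul_of_nonneg_right ?_ (shrink_nonneg hs0.le)
            exact (scaleWeight_le hc hu hs0).trans
              (Real.rpow_le_rpow_of_nonpos hs0 (by linarith) (by linarith))
        _ = s ^ (-d) / (1 + s) := by
            rw [shrink, Real.rpow_sub_one hs0.ne']; field_simp
    · rw [ENNReal.le_ofReal_iff_toReal_le hIt (by positivity)]; linarith
  refine (mul_le_mul' (inv_scaleMass_le hd hc hc1 hu) hnum).trans ?_
  rw [← ENNReal.ofReal_mul (by positivity)]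
  exact ENNReal.ofReal_le_ofReal (le_of_eq (by ring))

/-- The weight is at most c^(-d-1) on an interval of length ηc, so the powers of `c` cancel against
the total mass: for bounded `u`, the scale is rarely much smaller than `c`. -/
theorem scalePosterior_Iic_le {k : ℕ} {d c u η : ℝ} (hd : 0 < d) (hc : 0 < c) (hc1 : c ≤ 1)
    (hu : 0 ≤ u) :
    scalePosterior k d c u (Iic (η * c)) ≤
      ENNReal.ofReal (2 ^ (d + 1) * 2 ^ (k / 2 : ℝ) * Real.exp (u / 2) * η) := by
  rw [← lintegral_indicator_one measurableSet_Iic,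
    lintegral_scalePosterior (measurable_one.indicator measurableSet_Iic)]
  have hnum : ∫⁻ s in Ioi 0, ENNReal.ofReal (scaleWeight k d c u s) *
      (Iic (η * c)).indicator 1 s ≤ ENNReal.ofReal (c ^ (-d) * η) := by
    have h1 : ∀ s, ENNReal.ofReal (scaleWeight k d c u s) *
        (Iic (η * c)).indicator (1 : ℝ → ℝ≥0∞) s =
        (Iic (η * c)).indicator (fun s => ENNReal.ofReal (scaleWeight k d c u s)) s := by
      intro s
      by_cases hs : s ∈ Iic (η * c) <;> simp [hs]
    simp_rw [h1]
    rw [lintegral_indicator measurableSet_Iic, Measure.restrict_restrict measurableSet_Iic,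
      inter_comm, Ioi_inter_Iic]
    refine (setLIntegral_mono (measurable_const (a := ENNReal.ofReal (c ^ (-d - 1))))
      fun s hs => ENNReal.ofReal_le_ofReal ?_).trans ?_
    · exact (scaleWeight_le hc hu hs.1).trans
        (Real.rpow_le_rpow_of_nonpos hc (by linarith [hs.1]) (by linarith))
    · rw [setLIntegral_const, Real.volume_Ioc, ← ENNReal.ofReal_mul (by positivity),
        Real.rpow_sub_one hc.ne']
      exact ENNReal.ofReal_le_ofReal (le_of_eq (by field_simp; ring))
  refine (mul_le_mul' (inv_scaleMass_le hd hc hc1 hu) hnum).trans ?_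
  rw [← ENNReal.ofReal_mul (by positivity)]
  refine ENNReal.ofReal_le_ofReal (le_of_eq ?_)
  have : c ^ d * c ^ (-d) = 1 := by rw [← Real.rpow_add hc]; simp
  linear_combination 2 ^ (d + 1) * 2 ^ (k / 2 : ℝ) * Real.exp (u / 2) * η * this

/-- For large `u` the useful mass is at s of order `u`: on (u, 2u] the exponential is at least
e^(-1/2), and c + s and 1 + s are at most 3u. -/
theorem inv_scaleMass_le_of_one_le {k : ℕ} {d c u : ℝ} (hd : 0 < d) (hc : 0 < c) (hc1 : c ≤ 1)
    (hu : 1 ≤ u) :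
    (scaleMass k d c u)⁻¹ ≤
      ENNReal.ofReal (3 ^ (d + 1 + k / 2) * Real.exp (1 / 2) * u ^ (d + k / 2)) := by
  have hu0 : 0 < u := by linarith
  set m := (3 * u) ^ (-d - 1) * ((3 * u) ^ (-(k / 2 : ℝ)) * Real.exp (-1 / 2))
  refine inv_le_ofReal_of_ofReal_le (a := m * (2 * u - u)) ?_ ?_ ?_
  · have : 0 < 2 * u - u := by linarith
    positivity
  · have h1 : (3 * u) ^ (-d - 1) * (3 * u) ^ (-(k / 2 : ℝ)) =
        3 ^ (-(d + 1 + k / 2)) * (u ^ (-(d + k / 2)) / u) := by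
      rw [← Real.rpow_add (by positivity), Real.mul_rpow (by norm_num) hu0.le,
        ← Real.rpow_sub_one hu0.ne']
      congr 2 <;> ring
    have h2 : (3 : ℝ) ^ (-(d + 1 + k / 2)) * 3 ^ (d + 1 + k / 2) = 1 := by
      rw [← Real.rpow_add (by norm_num), neg_add_cancel, Real.rpow_zero]
    have h3 : Real.exp (-1 / 2) * Real.exp (1 / 2) = 1 := by
      rw [← Real.exp_add]; norm_num
    have h4 : u ^ (-(d + k / 2)) * u ^ (d + k / 2) = 1 := by
      rw [← Real.rpow_add hu0, neg_add_cancel, Real.rpow_zero]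
    calc m * (2 * u - u) * (3 ^ (d + 1 + k / 2) * Real.exp (1 / 2) * u ^ (d + k / 2))
        = ((3 * u) ^ (-d - 1) * (3 * u) ^ (-(k / 2 : ℝ))) * u * 3 ^ (d + 1 + k / 2) *
          u ^ (d + k / 2) * (Real.exp (-1 / 2) * Real.exp (1 / 2)) := by simp only [m]; ring
      _ = (3 ^ (-(d + 1 + k / 2)) * 3 ^ (d + 1 + k / 2)) *
          (u ^ (-(d + k / 2)) * u ^ (d + k / 2)) * (u / u) := by rw [h1, h3]; ring
      _ = 1 := by rw [h2, h4, div_self hu0.ne']; norm_num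
  · refine ofReal_mul_sub_le_setLIntegral (by fun_prop) hu0.le (fun s hs => ?_) (by positivity)
    have hs0 : u < s := hs.1
    have hs1 : 0 < s := hu0.trans hs0
    have hsc : s ≤ 2 * u := hs.2
    unfold scaleWeight
    refine mul_le_mul ?_ (mul_le_mul ?_ ?_ (by positivity) (by positivity)) (by positivity)
      (by positivity)
    · exact Real.rpow_le_rpow_of_nonpos (by linarith) (by linarith) (by linarith)
    · exact Real.rpow_le_rpow_of_nonpos (by linarith) (by linarith)
        (neg_nonpos.2 (by positivity))
    · rw [Real.exp_le_exp, neg_div, neg_div, neg_le_neg_iff, div_le_div_iff₀ (by linarith)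
        (by norm_num)]
      linarith

/-- This is where 2d is the critical constant. Near s = 0 the prior contributes c^(-d), at most
e^(ud/K), against the likelihood e^(-u/2); since d/K < 1/2, small scales are exponentially
negligible in `u`. The other scales are handled by a polynomial bound. -/
theorem lintegral_inv_one_add_le (k : ℕ) {d K : ℝ} (hd : 0 < d) (hK : 2 * d < K) :
    ∃ B : ℝ, 0 < B ∧ ∀ c u : ℝ, 0 < c → c ≤ 1 → 1 ≤ u → K * Real.log (1 / c) ≤ u →
      ∫⁻ s, ENNReal.ofReal (1 / (1 + s)) ∂(scalePosterior k d c u) ≤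
        ENNReal.ofReal (B * u ^ (-(3 / 4) : ℝ)) := by
  have hK0 : 0 < K := by linarith
  -- The extra exponent `e` makes s^(-1+e) integrable at 0 while keeping d + e < K/2.
  set e := min 1 ((K / 2 - d) / 2)
  have he0 : 0 < e := lt_min one_pos (by linarith)
  have he1 : e ≤ 1 := min_le_left _ _
  set a := (d + e) / K
  have ha0 : 0 < a := by positivity
  have ha : a < 1 / 2 := by
    have : e ≤ (K / 2 - d) / 2 := min_le_right _ _
    rw [div_lt_iff₀ hK0]; linarith
  set η := 1 / 2 - a
  have hη : 0 < η := by simp only [η]; linarith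
  set g := η / 2
  have hg : 0 < g := by positivity
  have hag : a + g ≤ 1 / (2 * (1 + η)) := by
    rw [le_div_iff₀ (by positivity)]
    have : a + g = (1 - η) / 2 := by simp only [g, η]; ring
    rw [this]; nlinarith
  -- Dividing u^(-p) by the total mass, of order at least u^(-(d+k/2)), leaves u^(-3/4). The
  -- exponent 3/4 must exceed 1/2, to beat a later factor ‖y‖ = u^(1/2), and be below 1, for
  -- integrability at infinity.
  set p := d + k / 2 + 3 / 4
  have hp : 0 < p := by positivity
  set A := (η / (1 + η)) ^ (-d - 1)
  have hA : 0 < A := by positivity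
  set I1 := ∫⁻ s in Ioc (0 : ℝ) η, ENNReal.ofReal (s ^ (-1 + e)) with hI1
  have hI1t : I1 ≠ ∞ := setLIntegral_Ioc_rpow_ne_top (by linarith) hη.le
  set I2 := ∫⁻ s in Ioi (η : ℝ), ENNReal.ofReal (s ^ (-(5 / 4) : ℝ)) with hI2
  have hI2t : I2 ≠ ∞ := setLIntegral_Ioi_rpow_ne_top (by norm_num) hη
  set N := p ^ p * g ^ (-p) * I1.toReal + A * (p ^ p * 2 ^ p) * I2.toReal
  have hN : 0 ≤ N := by positivity
  refine ⟨3 ^ (d + 1 + k / 2) * Real.exp (1 / 2) * (N + 1), by positivity,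
    fun c u hc hc1 hu hcu => ?_⟩
  have hu0 : 0 < u := by linarith
  rw [lintegral_scalePosterior (by fun_prop)]
  have hlow : ∀ s ∈ Ioc (0 : ℝ) η, scaleWeight k d c u s * (1 / (1 + s)) ≤
      p ^ p * g ^ (-p) * u ^ (-p) * s ^ (-1 + e) := by
    intro s hs
    have hs0 : 0 < s := hs.1
    have h1 : scaleWeight k d c u s * (1 / (1 + s)) ≤
        (c + s) ^ (-d - 1) * Real.exp (-u / (2 * (1 + s))) := by
      have h2 : (1 + s) ^ (-(k / 2 : ℝ)) ≤ 1 :=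
        Real.rpow_le_one_of_one_le_of_nonpos (by linarith) (neg_nonpos.2 (by positivity))
      have h3 : 1 / (1 + s) ≤ 1 := by rw [div_le_one (by linarith)]; linarith
      calc scaleWeight k d c u s * (1 / (1 + s)) ≤ scaleWeight k d c u s :=
            mul_le_of_le_one_right (scaleWeight_pos hc hs0).le h3
        _ ≤ _ := by
            unfold scaleWeight
            gcongr
            exact mul_le_of_le_one_left (Real.exp_pos _).le h2
    have h2 : (c + s) ^ (-d - 1) ≤ Real.exp (u * a) * s ^ (-1 + e) := by
      have h3 : (c + s) ^ (-d - 1) = (c + s) ^ (-(d + e)) * (c + s) ^ (-1 + e) := by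
        rw [← Real.rpow_add (by linarith)]; congr 1; ring
      have h4 : c ^ (-(d + e)) ≤ Real.exp (u * a) := by
        rw [Real.rpow_def_of_pos hc, Real.exp_le_exp]
        rw [one_div, Real.log_inv] at hcu
        have h5 : -Real.log c ≤ u / K := by rw [le_div_iff₀ hK0]; linarith
        calc Real.log c * -(d + e) = (-Real.log c) * (d + e) := by ring
          _ ≤ u / K * (d + e) := by gcongr
          _ = u * a := by simp only [a]; ring
      rw [h3]
      refine mul_le_mul (le_trans ?_ h4) ?_ (by positivity) (by positivity)
      · exact Real.rpow_le_rpow_of_nonpos hc (by linarith) (by linarith)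
      · exact Real.rpow_le_rpow_of_nonpos hs0 (by linarith) (by linarith)
    have h3 : Real.exp (-u / (2 * (1 + s))) ≤ Real.exp (-(u * a) + -(g * u)) := by
      rw [Real.exp_le_exp, neg_div]
      have h4 : 1 / (2 * (1 + η)) ≤ 1 / (2 * (1 + s)) :=
        one_div_le_one_div_of_le (by linarith) (by linarith [hs.2])
      have h5 : u * (a + g) ≤ u * (1 / (2 * (1 + s))) := by gcongr; exact hag.trans h4
      have h6 : u / (2 * (1 + s)) = u * (1 / (2 * (1 + s))) := by ring
      rw [h6]; linarith
    calc scaleWeight k d c u s * (1 / (1 + s))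
        ≤ (Real.exp (u * a) * s ^ (-1 + e)) * Real.exp (-(u * a) + -(g * u)) :=
          h1.trans (mul_le_mul h2 h3 (by positivity) (by positivity))
      _ = s ^ (-1 + e) * Real.exp (-(g * u)) := by
          rw [mul_right_comm, ← Real.exp_add, add_neg_cancel_left, mul_comm]
      _ ≤ s ^ (-1 + e) * (p ^ p * (g * u) ^ (-p)) := by
          gcongr; exact exp_neg_le_rpow hp (by positivity)
      _ = _ := by rw [Real.mul_rpow hg.le hu0.le]; ring
  -- The exponential is traded for a multiple of u^(-p) (1 + s)^p, and the surviving power of 1 + s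
  -- is -2 + 3/4 = -5/4.
  have hhigh : ∀ s ∈ Ioi η, scaleWeight k d c u s * (1 / (1 + s)) ≤
      A * (p ^ p * 2 ^ p) * u ^ (-p) * s ^ (-(5 / 4) : ℝ) := by
    intro s hs
    have hsη : η < s := hs
    have hs0 : 0 < s := hη.trans hsη
    have hs1 : 0 < 1 + s := by linarith
    have h1 : (c + s) ^ (-d - 1) ≤ A * (1 + s) ^ (-d - 1) := by
      rw [← Real.mul_rpow (by positivity) hs1.le]
      refine Real.rpow_le_rpow_of_nonpos (by positivity) ?_ (by linarith)
      rw [div_mul_eq_mul_div, div_le_iff₀ (by positivity)]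
      nlinarith
    have h2 : Real.exp (-u / (2 * (1 + s))) ≤ p ^ p * (2 ^ p * (u ^ (-p) * (1 + s) ^ p)) := by
      rw [neg_div]
      refine (exp_neg_le_rpow hp (by positivity)).trans (le_of_eq ?_)
      rw [Real.div_rpow hu0.le (by positivity), Real.mul_rpow (by norm_num) hs1.le,
        Real.rpow_neg (show (0 : ℝ) ≤ 2 by norm_num) p, Real.rpow_neg hs1.le p]
      field_simp
    have h3 : (1 + s) ^ (-d - 1) * (1 + s) ^ (-(k / 2 : ℝ)) * (1 + s) ^ p * (1 / (1 + s)) =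
        (1 + s) ^ (-(5 / 4) : ℝ) := by
      rw [mul_one_div, ← Real.rpow_add hs1, ← Real.rpow_add hs1, ← Real.rpow_sub_one hs1.ne']
      congr 1; simp only [p]; ring
    calc scaleWeight k d c u s * (1 / (1 + s))
        ≤ (A * (1 + s) ^ (-d - 1)) * ((1 + s) ^ (-(k / 2 : ℝ)) *
            (p ^ p * (2 ^ p * (u ^ (-p) * (1 + s) ^ p)))) * (1 / (1 + s)) := by
          unfold scaleWeight; gcongr
      _ = A * (p ^ p * 2 ^ p) * u ^ (-p) *
          ((1 + s) ^ (-d - 1) * (1 + s) ^ (-(k / 2 : ℝ)) * (1 + s) ^ p * (1 / (1 + s))) := by ring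
      _ = A * (p ^ p * 2 ^ p) * u ^ (-p) * (1 + s) ^ (-(5 / 4) : ℝ) := by rw [h3]
      _ ≤ _ := by
          gcongr ?_ * ?_
          exact Real.rpow_le_rpow_of_nonpos hs0 (by linarith) (by norm_num)
  have hnum : ∫⁻ s in Ioi 0, ENNReal.ofReal (scaleWeight k d c u s) *
      ENNReal.ofReal (1 / (1 + s)) ≤ ENNReal.ofReal (u ^ (-p) * (N + 1)) := by
    have h1 : ∫⁻ s in Ioc 0 η, ENNReal.ofReal (scaleWeight k d c u s) *
        ENNReal.ofReal (1 / (1 + s)) ≤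
        ENNReal.ofReal (p ^ p * g ^ (-p) * u ^ (-p)) * ENNReal.ofReal I1.toReal := by
      rw [ENNReal.ofReal_toReal hI1t, hI1, ← lintegral_const_mul _ (by fun_prop)]
      refine setLIntegral_mono (by fun_prop) fun s hs => ?_
      rw [← ENNReal.ofReal_mul (scaleWeight_pos hc hs.1).le, ← ENNReal.ofReal_mul (by positivity)]
      exact ENNReal.ofReal_le_ofReal (hlow s hs)
    have h2 : ∫⁻ s in Ioi η, ENNReal.ofReal (scaleWeight k d c u s) *
        ENNReal.ofReal (1 / (1 + s)) ≤
        ENNReal.ofReal (A * (p ^ p * 2 ^ p) * u ^ (-p)) * ENNReal.ofReal I2.toReal := by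
      rw [ENNReal.ofReal_toReal hI2t, hI2, ← lintegral_const_mul _ (by fun_prop)]
      refine setLIntegral_mono (by fun_prop) fun s hs => ?_
      rw [← ENNReal.ofReal_mul (scaleWeight_pos hc (hη.trans hs)).le,
        ← ENNReal.ofReal_mul (by positivity)]
      exact ENNReal.ofReal_le_ofReal (hhigh s hs)
    rw [← Ioc_union_Ioi_eq_Ioi hη.le,
      lintegral_union measurableSet_Ioi (Set.Ioc_disjoint_Ioi le_rfl)]
    refine (add_le_add h1 h2).trans ?_
    rw [← ENNReal.ofReal_mul (by positivity), ← ENNReal.ofReal_mul (by positivity),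
      ← ENNReal.ofReal_add (by positivity) (by positivity)]
    refine ENNReal.ofReal_le_ofReal ?_
    have : 0 < u ^ (-p) := by positivity
    simp only [N]
    nlinarith
  refine (mul_le_mul' (inv_scaleMass_le_of_one_le hd hc hc1 hu) hnum).trans ?_
  rw [← ENNReal.ofReal_mul (by positivity)]
  refine ENNReal.ofReal_le_ofReal (le_of_eq ?_)
  have : u ^ (d + k / 2) * u ^ (-p) = u ^ (-(3 / 4) : ℝ) := by
    rw [← Real.rpow_add hu0]; congr 1; simp only [p]; ring
  rw [← this]; ring

/-! ### Posterior mean and bounds on the radius. -/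

section Posterior

variable {k : ℕ} {V : Matrix (Fin k) (Fin k) ℝ} {d c α : ℝ} {y : EuclideanSpace ℝ (Fin k)}

/-- The posterior mean of the shrinkage factor. -/
noncomputable def meanShrink (k : ℕ) (d c u : ℝ) : ℝ := ∫ s, shrink s ∂(scalePosterior k d c u)

theorem integrable_shrink {u : ℝ} (hd : 0 < d) (hc : 0 < c) (hu : 0 ≤ u) :
    Integrable shrink (scalePosterior k d c u) := by
  have := isProbabilityMeasure_scalePosterior (k := k) hd hc hu
  refine Integrable.of_bound (by fun_prop) 1 ?_
  filter_upwards [ae_pos_scalePosterior] with s hs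
  rw [Real.norm_of_nonneg (shrink_nonneg hs.le)]
  exact shrink_le_one hs.le

theorem ofReal_meanShrink {u : ℝ} (hd : 0 < d) (hc : 0 < c) (hu : 0 ≤ u) :
    ENNReal.ofReal (meanShrink k d c u) =
      ∫⁻ s, ENNReal.ofReal (shrink s) ∂(scalePosterior k d c u) := by
  refine ofReal_integral_eq_lintegral_ofReal (integrable_shrink hd hc hu) ?_
  filter_upwards [ae_pos_scalePosterior] with s hs using shrink_nonneg hs.le

theorem meanShrink_nonneg {u : ℝ} : 0 ≤ meanShrink k d c u := by
  refine integral_nonneg_of_ae ?_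
  filter_upwards [ae_pos_scalePosterior] with s hs using shrink_nonneg hs.le

/-- The Gaussian part of the mixture is independent of the scale and centred, so only the averaged
shrinkage remains. -/
theorem estimator_sqrtMap (hV : V.PosDef) (hd : 0 < d) (hc : 0 < c) :
    estimator V d c (sqrtMap V y) = sqrtMap V (meanShrink k d c (‖y‖ ^ 2) • y) := by
  have hP := isProbabilityMeasure_scalePosterior (k := k) hd hc (sq_nonneg ‖y‖)
  set ν := scalePosterior k d c (‖y‖ ^ 2) with hν
  set γ := stdGaussian (EuclideanSpace ℝ (Fin k))
  have hid : Integrable (fun z : EuclideanSpace ℝ (Fin k) => z) γ := IsGaussian.integrable_fun_id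
  have hs1 := integrable_shrink (k := k) hd hc (sq_nonneg ‖y‖)
  have hs2 : Integrable (fun s => Real.sqrt (shrink s)) ν := by
    refine Integrable.of_bound (by fun_prop) 1 ?_
    filter_upwards [ae_pos_scalePosterior] with s hs
    rw [Real.norm_of_nonneg (Real.sqrt_nonneg _)]
    exact Real.sqrt_le_one.2 (shrink_le_one hs.le)
  have h1 : Integrable (fun q : ℝ × EuclideanSpace ℝ (Fin k) => shrink q.1 • y) (ν.prod γ) :=
    (hs1.comp_fst γ).smul_const y
  have h2 : Integrable (fun q : ℝ × EuclideanSpace ℝ (Fin k) => Real.sqrt (shrink q.1) • q.2)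
      (ν.prod γ) := hs2.smul_prod hid
  have h3 := (sqrtMap V).integral_comp_comm (h1.add h2)
  simp only [Pi.add_apply] at h3
  rw [estimator, posterior_eq_map hV hd hc, integral_map (by fun_prop) (by fun_prop),
    h3, integral_add h1 h2,
    integral_prod_smul (fun s => Real.sqrt (shrink s)) (fun z : EuclideanSpace ℝ (Fin k) => z),
    integral_smul_const, integral_fun_fst]
  have : ∫ z, z ∂γ = 0 := integral_id_stdGaussian
  rw [this, smul_zero, add_zero]
  simp [meanShrink, hν]

theorem posterior_ball (hV : V.PosDef) (hd : 0 < d) (hc : 0 < c)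
    (b : EuclideanSpace ℝ (Fin k)) (r : ℝ) :
    posterior V d c (sqrtMap V y) {θ | mahalSq V (θ - sqrtMap V b) ≤ r} =
      ((scalePosterior k d c (‖y‖ ^ 2)).prod (stdGaussian (EuclideanSpace ℝ (Fin k))))
        {q | ‖shrink q.1 • y + Real.sqrt (shrink q.1) • q.2 - b‖ ^ 2 ≤ r} := by
  have hm : MeasurableSet {θ : EuclideanSpace ℝ (Fin k) | mahalSq V (θ - sqrtMap V b) ≤ r} := by
    have : Measurable (mahalSq V) := measurable_mahalSq
    exact measurableSet_le (by fun_prop) (by fun_prop)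
  rw [posterior_eq_map hV hd hc, Measure.map_apply (by fun_prop) hm]
  congr 1
  ext q
  simp only [mem_preimage, mem_ofPred_eq]
  rw [← map_sub, mahalSq_sqrtMap hV]

theorem isProbabilityMeasure_posterior (hV : V.PosDef) (hd : 0 < d) (hc : 0 < c) :
    IsProbabilityMeasure (posterior V d c (sqrtMap V y)) := by
  have hP := isProbabilityMeasure_scalePosterior (k := k) hd hc (sq_nonneg ‖y‖)
  rw [posterior_eq_map hV hd hc]
  exact Measure.isProbabilityMeasure_map (by fun_prop)

/-- The second moment of the standard Gaussian law. -/
noncomputable def secondMoment (k : ℕ) : ℝ :=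
  ∫ z, ‖z‖ ^ 2 ∂(stdGaussian (EuclideanSpace ℝ (Fin k)))

theorem secondMoment_nonneg : 0 ≤ secondMoment k := integral_nonneg fun _ => sq_nonneg _

theorem integrable_norm_sq :
    Integrable (fun z : EuclideanSpace ℝ (Fin k) => ‖z‖ ^ 2)
      (stdGaussian (EuclideanSpace ℝ (Fin k))) :=
  (IsGaussian.memLp_two_id (μ := stdGaussian (EuclideanSpace ℝ (Fin k)))).integrable_norm_pow
    (by norm_num)

/-- Markov's inequality for the squared distance to the posterior mean. Since κ and m lie in [0, 1],
(κ - m)² ≤ κ + m, so the expectation is at most m (4‖y‖² + 2E‖z‖²). The summand 1 and the positive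
`q` keep the radius positive. Besides bounding the radius above, this shows that the set defining it
is nonempty. -/
theorem one_sub_le_posterior_ball (hV : V.PosDef) (hd : 0 < d) (hc : 0 < c) {q : ℝ} (hq : 0 < q)
    (hα : 0 < α) (hmq : meanShrink k d c (‖y‖ ^ 2) ≤ q) :
    1 - α ≤ (posterior V d c (sqrtMap V y)).real
      {θ | mahalSq V (θ - estimator V d c (sqrtMap V y)) ≤
        (4 * ‖y‖ ^ 2 + 2 * secondMoment k + 1) * q / α} := by
  have hP := isProbabilityMeasure_scalePosterior (k := k) hd hc (sq_nonneg ‖y‖)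
  have hs1 := integrable_shrink (k := k) hd hc (sq_nonneg ‖y‖)
  set ν := scalePosterior k d c (‖y‖ ^ 2) with hν
  set γ := stdGaussian (EuclideanSpace ℝ (Fin k))
  set m := meanShrink k d c (‖y‖ ^ 2) with hm
  have hm0 : 0 ≤ m := meanShrink_nonneg
  have hM : 0 ≤ secondMoment k := secondMoment_nonneg
  set r := (4 * ‖y‖ ^ 2 + 2 * secondMoment k + 1) * q / α with hr
  have hr0 : 0 < r := by positivity
  set D : ℝ × EuclideanSpace ℝ (Fin k) → ℝ := fun p =>
    ‖shrink p.1 • y + Real.sqrt (shrink p.1) • p.2 - m • y‖ ^ 2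
  have hD : Measurable D := by fun_prop
  set F : ℝ × EuclideanSpace ℝ (Fin k) → ℝ := fun p =>
    shrink p.1 * (2 * ‖y‖ ^ 2 + 2 * ‖p.2‖ ^ 2) + 2 * m * ‖y‖ ^ 2
  have hG : Integrable (fun z : EuclideanSpace ℝ (Fin k) => 2 * ‖y‖ ^ 2 + 2 * ‖z‖ ^ 2) γ :=
    (integrable_const _).add (integrable_norm_sq.const_mul 2)
  have hF1 : Integrable (fun p : ℝ × EuclideanSpace ℝ (Fin k) =>
      shrink p.1 * (2 * ‖y‖ ^ 2 + 2 * ‖p.2‖ ^ 2)) (ν.prod γ) := hs1.mul_prod hG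
  have hF : Integrable F (ν.prod γ) := hF1.add (integrable_const _)
  have hDF : ∀ᵐ p ∂(ν.prod γ), D p ≤ F p := by
    have hpos : ∀ᵐ p ∂(ν.prod γ), 0 < p.1 :=
      Measure.quasiMeasurePreserving_fst.ae ae_pos_scalePosterior
    filter_upwards [hpos] with p hp
    have hs0 := shrink_nonneg hp.le
    have hs1 := shrink_le_one hp.le
    have e1 : shrink p.1 • y + Real.sqrt (shrink p.1) • p.2 - m • y =
        (shrink p.1 - m) • y + Real.sqrt (shrink p.1) • p.2 := by rw [sub_smul]; abel
    have hm1 : m ≤ 1 := by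
      have h2 : m ≤ ∫ _, (1 : ℝ) ∂ν := by
        refine integral_mono_ae (integrable_shrink hd hc (sq_nonneg _)) (integrable_const _) ?_
        filter_upwards [ae_pos_scalePosterior] with s hs using shrink_le_one hs.le
      simpa using h2
    simp only [D, F]
    rw [e1]
    have e2 := norm_add_le ((shrink p.1 - m) • y) (Real.sqrt (shrink p.1) • p.2)
    have e3 : ‖(shrink p.1 - m) • y‖ ^ 2 ≤ (shrink p.1 + m) * ‖y‖ ^ 2 := by
      rw [norm_smul, mul_pow, Real.norm_eq_abs, sq_abs]
      refine mul_le_mul_of_nonneg_right ?_ (sq_nonneg _)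
      nlinarith
    have e4 : ‖Real.sqrt (shrink p.1) • p.2‖ ^ 2 = shrink p.1 * ‖p.2‖ ^ 2 := by
      rw [norm_smul, mul_pow, Real.norm_of_nonneg (Real.sqrt_nonneg _), Real.sq_sqrt hs0]
    have e5 := pow_le_pow_left₀ (norm_nonneg _) e2 2
    nlinarith [sq_nonneg (‖(shrink p.1 - m) • y‖ - ‖Real.sqrt (shrink p.1) • p.2‖)]
  have hDi : Integrable D (ν.prod γ) := by
    refine hF.mono' hD.aestronglyMeasurable ?_
    filter_upwards [hDF] with p hp
    rwa [Real.norm_of_nonneg (sq_nonneg _)]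
  have hint : ∫ p, D p ∂(ν.prod γ) ≤ r * α := by
    have h1 : ∫ p, F p ∂(ν.prod γ) = m * (2 * ‖y‖ ^ 2 + 2 * secondMoment k) + 2 * m * ‖y‖ ^ 2 := by
      have h2 : ∫ z, 2 * ‖z‖ ^ 2 ∂γ = 2 * secondMoment k := integral_const_mul _ _
      rw [integral_add hF1 (integrable_const _),
        integral_prod_mul (μ := ν) (ν := γ) shrink (fun z => 2 * ‖y‖ ^ 2 + 2 * ‖z‖ ^ 2),
        integral_add (integrable_const _) (integrable_norm_sq.const_mul 2), h2]
      simp [hm, meanShrink, hν]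
    refine (integral_mono_ae hDi hF hDF).trans ?_
    rw [h1, hr, div_mul_cancel₀ _ hα.ne']
    nlinarith [mul_le_mul_of_nonneg_right hmq
      (show 0 ≤ 4 * ‖y‖ ^ 2 + 2 * secondMoment k by positivity)]
  have hmk := mul_meas_ge_le_integral_of_nonneg (ae_of_all (ν.prod γ) fun p => sq_nonneg _) hDi r
  have hle : (ν.prod γ).real {p | r ≤ D p} ≤ α := by
    have := hmk.trans hint
    exact le_of_mul_le_mul_left this hr0
  rw [estimator_sqrtMap hV hd hc, measureReal_def, posterior_ball hV hd hc, ← measureReal_def]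
  have hms : MeasurableSet {p | D p ≤ r} := measurableSet_le hD measurable_const
  have h3 := probReal_compl_eq_one_sub (μ := ν.prod γ) hms
  have h5 : {p | D p ≤ r}ᶜ ⊆ {p | r ≤ D p} := fun p hp => (not_le.1 (show ¬ D p ≤ r from hp)).le
  have h4 : (ν.prod γ).real {p | D p ≤ r}ᶜ ≤ α := (measureReal_mono h5).trans hle
  change 1 - α ≤ (ν.prod γ).real {p | D p ≤ r}
  linarith

theorem mahalSq_nonneg (hV : V.PosDef) (x : EuclideanSpace ℝ (Fin k)) : 0 ≤ mahalSq V x := by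
  obtain ⟨z, rfl⟩ := sqrtMap_surjective hV x
  rw [mahalSq_sqrtMap hV]; positivity

theorem nonneg_of_one_sub_le_posterior_ball (hV : V.PosDef) (hα1 : α < 1)
    {x b : EuclideanSpace ℝ (Fin k)} {r : ℝ}
    (h : 1 - α ≤ (posterior V d c x).real {θ | mahalSq V (θ - b) ≤ r}) : 0 ≤ r := by
  by_contra! hr
  have : {θ | mahalSq V (θ - b) ≤ r} = ∅ := by
    ext θ
    simpa using hr.trans_le (mahalSq_nonneg hV _)
  rw [this, measureReal_empty] at h
  linarith

theorem radius_le (hV : V.PosDef) (hd : 0 < d) (hc : 0 < c) {q : ℝ} (hq : 0 < q)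
    (hα : 0 < α) (hα1 : α < 1) (hmq : meanShrink k d c (‖y‖ ^ 2) ≤ q) :
    radius V d c α (sqrtMap V y) ≤ (4 * ‖y‖ ^ 2 + 2 * secondMoment k + 1) * q / α :=
  csInf_le ⟨0, fun _ hr => nonneg_of_one_sub_le_posterior_ball hV hα1 hr⟩
    (one_sub_le_posterior_ball hV hd hc hq hα hmq)

theorem radius_nonneg (hV : V.PosDef) (hα1 : α < 1) (x : EuclideanSpace ℝ (Fin k)) :
    0 ≤ radius V d c α x :=
  Real.sInf_nonneg fun _ hr => nonneg_of_one_sub_le_posterior_ball hV hα1 hr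

theorem stdGaussian_affine_ball_le (a b : EuclideanSpace ℝ (Fin k)) {κ t : ℝ} (hκ : 0 < κ)
    (ht : 0 ≤ t) :
    stdGaussian (EuclideanSpace ℝ (Fin k)) {z | ‖a + Real.sqrt κ • z - b‖ ^ 2 ≤ t} ≤
      stdGaussian (EuclideanSpace ℝ (Fin k)) {z | ‖z‖ ^ 2 ≤ t / κ} := by
  have hs : 0 < Real.sqrt κ := Real.sqrt_pos.2 hκ
  have h1 : {z | ‖a + Real.sqrt κ • z - b‖ ^ 2 ≤ t} =
      Metric.closedBall ((Real.sqrt κ)⁻¹ • (b - a)) (Real.sqrt (t / κ)) := by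
    ext z
    rw [mem_ofPred_eq, mem_closedBall_iff_norm, Real.le_sqrt (norm_nonneg _) (by positivity),
      le_div_iff₀ hκ]
    have : a + Real.sqrt κ • z - b = Real.sqrt κ • (z - (Real.sqrt κ)⁻¹ • (b - a)) := by
      rw [smul_sub, smul_inv_smul₀ hs.ne']; abel
    rw [this, norm_smul, mul_pow, Real.norm_of_nonneg hs.le, Real.sq_sqrt hκ.le, mul_comm]
  have h2 : {z : EuclideanSpace ℝ (Fin k) | ‖z‖ ^ 2 ≤ t / κ} =
      Metric.closedBall 0 (Real.sqrt (t / κ)) := by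
    ext z
    rw [mem_ofPred_eq, mem_closedBall_zero_iff, Real.le_sqrt (norm_nonneg _) (by positivity)]
  rw [h1, h2]
  exact stdGaussian_ball_le_centered _ (Real.sqrt_nonneg _)

/-- Off an event of posterior mass at most `a`, κ is at least `shrink A`, and then any ball of
squared radius `t`, wherever centred, has conditional mass at most `b`. A mass a + b < 1 - α is too
small for a credible ball, and the location of the posterior mean plays no role. -/
theorem le_radius (hV : V.PosDef) (hd : 0 < d) (hc : 0 < c) (hα : 0 < α)
    {t A a b : ℝ} (ht : 0 ≤ t) (hA : 0 < A) (ha : 0 ≤ a) (hb : 0 ≤ b)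
    (hs : scalePosterior k d c (‖y‖ ^ 2) (Iic A) ≤ ENNReal.ofReal a)
    (hg : chiSq k (Iic (t / shrink A)) ≤ ENNReal.ofReal b) (hab : a + b < 1 - α) :
    t ≤ radius V d c α (sqrtMap V y) := by
  have hP := isProbabilityMeasure_scalePosterior (k := k) hd hc (sq_nonneg ‖y‖)
  have hPP := isProbabilityMeasure_posterior (y := y) hV hd hc
  refine le_csInf ⟨_, one_sub_le_posterior_ball hV hd hc (q := meanShrink k d c (‖y‖ ^ 2) + 1)
    (by linarith [meanShrink_nonneg (k := k) (d := d) (c := c) (u := ‖y‖ ^ 2)]) hα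
    (by linarith)⟩ fun r hr => ?_
  by_contra! hrt
  have hr2 : 1 - α ≤ (posterior V d c (sqrtMap V y)).real
      {θ | mahalSq V (θ - estimator V d c (sqrtMap V y)) ≤ t} :=
    hr.trans (measureReal_mono fun θ hθ => le_trans hθ hrt.le)
  rw [estimator_sqrtMap hV hd hc, measureReal_def, posterior_ball hV hd hc] at hr2
  set m := meanShrink k d c (‖y‖ ^ 2)
  have hmeas : MeasurableSet {q : ℝ × EuclideanSpace ℝ (Fin k) |
      ‖shrink q.1 • y + Real.sqrt (shrink q.1) • q.2 - m • y‖ ^ 2 ≤ t} :=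
    measurableSet_le (by fun_prop) (by fun_prop)
  have key : ∀ s, 0 < s → stdGaussian (EuclideanSpace ℝ (Fin k))
      {z | ‖shrink s • y + Real.sqrt (shrink s) • z - m • y‖ ^ 2 ≤ t} ≤
      (Iic A).indicator 1 s + ENNReal.ofReal b := by
    intro s hs0
    by_cases hsA : s ≤ A
    · rw [indicator_of_mem (mem_Iic.2 hsA)]
      exact prob_le_one.trans le_self_add
    · rw [indicator_of_notMem (show s ∉ Iic A from hsA), zero_add]
      have hsA : A < s := not_le.1 hsA
      have hκA : 0 < shrink A := by unfold shrink; positivity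
      have hκ : shrink A ≤ shrink s := by
        unfold shrink
        rw [div_le_div_iff₀ (by linarith) (by linarith)]
        linarith
      refine (stdGaussian_affine_ball_le _ _ (hκA.trans_le hκ) ht).trans (le_trans ?_ hg)
      rw [chiSq_apply measurableSet_Iic]
      refine measure_mono fun z hz => ?_
      exact le_trans (b := t / shrink s) hz (div_le_div_of_nonneg_left ht hκA hκ)
  have hle : ((scalePosterior k d c (‖y‖ ^ 2)).prod (stdGaussian (EuclideanSpace ℝ (Fin k))))
      {q | ‖shrink q.1 • y + Real.sqrt (shrink q.1) • q.2 - m • y‖ ^ 2 ≤ t} ≤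
      ENNReal.ofReal (a + b) := by
    rw [Measure.prod_apply hmeas]
    refine (lintegral_mono_ae (ae_pos_scalePosterior.mono fun s hs => key s hs)).trans ?_
    rw [lintegral_add_right _ measurable_const, lintegral_indicator_one measurableSet_Iic,
      lintegral_const, measure_univ, mul_one, ENNReal.ofReal_add ha hb]
    gcongr
  have := ENNReal.toReal_le_of_le_ofReal (by positivity) hle
  linarith

end Posterior

/-! ### Quantiles of the chi-squared law. -/

section ChiSq

variable {k : ℕ} {p t : ℝ}

theorem chiSq_Ioi_real (k : ℕ) (t : ℝ) :
    (chiSq k).real (Ioi t) = 1 - (chiSq k).real (Iic t) := by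
  rw [← compl_Iic, probReal_compl_eq_one_sub measurableSet_Iic]

theorem exists_one_sub_le_chiSq (k : ℕ) (hp : 0 < p) :
    ∃ M, 0 < M ∧ 1 - p ≤ (chiSq k).real (Iic M) := by
  have h := (tendsto_cdf_atTop (chiSq k)).eventually (lt_mem_nhds (show 1 - p < 1 by linarith))
  obtain ⟨M, hM, hM0⟩ := (h.and (eventually_gt_atTop 0)).exists
  exact ⟨M, hM0, by rw [← cdf_eq_real]; exact hM.le⟩

/-- For k > 0 there is no atom at 0, and a distribution function is right-continuous. -/
theorem exists_chiSq_Iic_le (hk : 0 < k) (hp : 0 < p) :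
    ∃ t, 0 < t ∧ (chiSq k).real (Iic t) ≤ p := by
  have h0 : cdf (chiSq k) 0 = 0 := by
    have : {z : EuclideanSpace ℝ (Fin k) | ‖z‖ ^ 2 ∈ Iic (0 : ℝ)} = {0} := by
      ext z
      simp
    rw [cdf_eq_real, measureReal_def, chiSq_apply measurableSet_Iic, this,
      stdGaussian_singleton hk, ENNReal.toReal_zero]
  have h1 := ((cdf (chiSq k)).right_continuous 0).mono_left (nhdsWithin_mono 0 Ioi_subset_Ici_self)
  rw [h0] at h1
  obtain ⟨t, ht, ht0⟩ := ((h1.eventually (gt_mem_nhds hp)).and self_mem_nhdsWithin).exists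
  exact ⟨t, ht0, by rw [← cdf_eq_real]; exact ht.le⟩

/-- A point strictly beyond the quantile suffices later, which avoids continuity of the chi-squared
law; `chiSq_lt_of_lt_upper` is the counterpart below the quantile. -/
theorem one_sub_le_chiSq_of_upper_lt (hp : 0 < p) (h : chiSqUpper k p < t) :
    1 - p ≤ (chiSq k).real (Iic t) := by
  obtain ⟨M, -, hM⟩ := exists_one_sub_le_chiSq k hp
  obtain ⟨s, hs, hst⟩ := exists_lt_of_csInf_lt
    (s := {t : ℝ | (chiSq k).real (Ioi t) ≤ p})
    ⟨M, show (chiSq k).real (Ioi M) ≤ p by rw [chiSq_Ioi_real]; linarith⟩ h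
  have hs' : (chiSq k).real (Ioi s) ≤ p := hs
  rw [chiSq_Ioi_real] at hs'
  have : (chiSq k).real (Iic s) ≤ (chiSq k).real (Iic t) :=
    measureReal_mono (Iic_subset_Iic.2 hst.le)
  linarith

theorem nonneg_of_chiSq_Ioi_le (hp : p < 1) (h : (chiSq k).real (Ioi t) ≤ p) : 0 ≤ t := by
  by_contra! ht
  have h1 : (chiSq k).real (Iic t) = 0 := by
    rw [measureReal_def, measure_mono_null (Iic_subset_Iio.2 ht) chiSq_Iio_zero,
      ENNReal.toReal_zero]
  rw [chiSq_Ioi_real, h1] at h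
  linarith

theorem chiSqUpper_nonneg (hp : p < 1) : 0 ≤ chiSqUpper k p :=
  Real.sInf_nonneg fun _ h => nonneg_of_chiSq_Ioi_le hp h

theorem chiSq_lt_of_lt_upper (hp : p < 1) (h : t < chiSqUpper k p) :
    (chiSq k).real (Iic t) < 1 - p := by
  by_contra! hc
  have h1 : chiSqUpper k p ≤ t :=
    csInf_le ⟨0, fun s hs => nonneg_of_chiSq_Ioi_le hp hs⟩
      (show (chiSq k).real (Ioi t) ≤ p by rw [chiSq_Ioi_real]; linarith)
  linarith

theorem chiSqUpper_pos (hk : 0 < k) (hp0 : 0 < p) (hp : p < 1) : 0 < chiSqUpper k p := by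
  obtain ⟨t, ht0, ht⟩ := exists_chiSq_Iic_le hk (p := (1 - p) / 2) (by linarith)
  obtain ⟨M, -, hM⟩ := exists_one_sub_le_chiSq k hp0
  refine ht0.trans_le (le_csInf
    ⟨M, show (chiSq k).real (Ioi M) ≤ p by rw [chiSq_Ioi_real]; linarith⟩ fun s hs => ?_)
  have hs' : (chiSq k).real (Ioi s) ≤ p := hs
  by_contra! hst
  have h1 : (chiSq k).real (Iic s) ≤ (chiSq k).real (Iic t) :=
    measureReal_mono (Iic_subset_Iic.2 hst.le)
  rw [chiSq_Ioi_real] at hs'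
  linarith

end ChiSq

/-! ### Reduction of coverage to a deterministic statement on a noise ball. -/

section Reduction

variable {k : ℕ} {V : Matrix (Fin k) (Fin k) ℝ} {d c α ρ L : ℝ}

/-- The event contains a Mahalanobis ball about the true mean, whose probability is a chi-squared
probability. Only the ball has to be measurable, so nothing is needed about measurability of the
coverage event. -/
theorem chiSq_le_multivariateGaussian (hV : V.PosDef) {η : EuclideanSpace ℝ (Fin k)} {M : ℝ}
    {P : EuclideanSpace ℝ (Fin k) → Prop} (h : ∀ z, ‖z‖ ^ 2 ≤ M → P (sqrtMap V (η + z))) :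
    (chiSq k).real (Iic M) ≤ (multivariateGaussian (sqrtMap V η) V).real {x | P x} := by
  have hmah : Measurable (mahalSq V) := measurable_mahalSq
  have hm : MeasurableSet {x | mahalSq V (x - sqrtMap V η) ≤ M} :=
    measurableSet_le (by fun_prop) measurable_const
  have h1 : (chiSq k).real (Iic M) =
      (multivariateGaussian (sqrtMap V η) V).real {x | mahalSq V (x - sqrtMap V η) ≤ M} := by
    rw [measureReal_def, measureReal_def, chiSq_apply measurableSet_Iic, multivariateGaussian,
      Measure.map_apply (by fun_prop) hm]
    congr 2
    ext z
    change ‖z‖ ^ 2 ≤ M ↔ mahalSq V (sqrtMap V η + sqrtMap V z - sqrtMap V η) ≤ M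
    rw [add_sub_cancel_left, mahalSq_sqrtMap hV]
  rw [h1]
  refine measureReal_mono fun x hx => ?_
  obtain ⟨z, hz⟩ := sqrtMap_surjective hV (x - sqrtMap V η)
  have hx' : mahalSq V (x - sqrtMap V η) ≤ M := hx
  rw [← hz, mahalSq_sqrtMap hV] at hx'
  have := h z hx'
  rwa [map_add, hz, add_sub_cancel] at this

theorem mem_credibleSet_iff (hV : V.PosDef) (hd : 0 < d) (hc : 0 < c)
    {η y : EuclideanSpace ℝ (Fin k)} :
    sqrtMap V η ∈ credibleSet V d c α ρ L (sqrtMap V y) ↔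
      ‖η - meanShrink k d c (‖y‖ ^ 2) • y‖ ^ 2 ≤
        L * radius V d c α (sqrtMap V y) ^ (d / (1 + ρ)) := by
  rw [credibleSet, mem_ofPred_eq, estimator_sqrtMap hV hd hc, ← map_sub, mahalSq_sqrtMap hV]

end Reduction

/-! ### Limits as c tends to 0. -/

section Asymptotics

theorem tendsto_log_one_div : Tendsto (fun c : ℝ => Real.log (1 / c)) (𝓝[>] 0) atTop := by
  simp_rw [one_div, Real.log_inv]
  exact tendsto_neg_atBot_atTop.comp Real.tendsto_log_nhdsGT_zero

theorem tendsto_rpow_nhdsGT_zero {a : ℝ} (ha : 0 < a) :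
    Tendsto (fun c : ℝ => c ^ a) (𝓝[>] 0) (𝓝 0) := by
  have := (Real.continuousAt_rpow_const 0 a (Or.inr ha.le)).tendsto
  rw [Real.zero_rpow ha.ne'] at this
  exact this.mono_left nhdsWithin_le_nhds

theorem tendsto_rpow_mul_log_one_div {a : ℝ} (ha : 0 < a) :
    Tendsto (fun c : ℝ => c ^ a * Real.log (1 / c)) (𝓝[>] 0) (𝓝 0) := by
  have h := (tendsto_log_mul_rpow_nhdsGT_zero ha).neg
  rw [neg_zero] at h
  refine h.congr fun c => ?_
  rw [one_div, Real.log_inv]; ring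

/-- Young's inequality. A small `δ` lets bounded noise be added without crossing the critical level
2d log(1/c). -/
theorem norm_add_sq_le_of_pos {E : Type*} [SeminormedAddCommGroup E] (a b : E) {δ : ℝ}
    (hδ : 0 < δ) : ‖a + b‖ ^ 2 ≤ (1 + δ) * ‖a‖ ^ 2 + (1 + 1 / δ) * ‖b‖ ^ 2 := by
  have h1 := pow_le_pow_left₀ (norm_nonneg _) (norm_add_le a b) 2
  have h2 : 0 ≤ δ * (‖a‖ - ‖b‖ / δ) ^ 2 := by positivity
  have h3 : δ * (‖a‖ - ‖b‖ / δ) ^ 2 = δ * ‖a‖ ^ 2 - 2 * ‖a‖ * ‖b‖ + 1 / δ * ‖b‖ ^ 2 := by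
    field_simp
    ring
  nlinarith

end Asymptotics

/-! ### Bounds on the mean shrinkage. -/

section ShrinkBounds

variable {k : ℕ} {d : ℝ}

theorem meanShrink_le_rpow_mul_exp (k : ℕ) (hd : 0 < d) (hd1 : d < 1) :
    ∃ B : ℝ, 0 < B ∧ ∀ c u : ℝ, 0 < c → c ≤ 1 → 0 ≤ u →
      meanShrink k d c u ≤ B * c ^ d * Real.exp (u / 2) := by
  obtain ⟨B, hB, h⟩ := lintegral_shrink_le k hd hd1
  refine ⟨B, hB, fun c u hc hc1 hu => ?_⟩
  have := h c u hc hc1 hu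
  rw [← ofReal_meanShrink hd hc hu] at this
  exact (ENNReal.ofReal_le_ofReal_iff (by positivity)).1 this

theorem one_sub_meanShrink_le (k : ℕ) {K : ℝ} (hd : 0 < d) (hK : 2 * d < K) :
    ∃ B : ℝ, 0 < B ∧ ∀ c u : ℝ, 0 < c → c ≤ 1 → 1 ≤ u → K * Real.log (1 / c) ≤ u →
      1 - meanShrink k d c u ≤ B * u ^ (-(3 / 4) : ℝ) ∧ meanShrink k d c u ≤ 1 ∧
      ∀ A, 0 < A → scalePosterior k d c u (Iic A) ≤
        ENNReal.ofReal ((1 + A) * (B * u ^ (-(3 / 4) : ℝ))) := by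
  obtain ⟨B, hB, h⟩ := lintegral_inv_one_add_le k hd hK
  refine ⟨B, hB, fun c u hc hc1 hu hcu => ?_⟩
  have hu0 : 0 < u := by linarith
  have h1 := h c u hc hc1 hu hcu
  have hP := isProbabilityMeasure_scalePosterior (k := k) hd hc hu0.le
  have hi := integrable_shrink (k := k) hd hc hu0.le
  have he : ∀ᵐ s ∂(scalePosterior k d c u), 1 - shrink s = 1 / (1 + s) := by
    filter_upwards [ae_pos_scalePosterior] with s hs
    rw [shrink]; field_simp; ring
  have h2 : 1 - meanShrink k d c u = ∫ s, 1 - shrink s ∂(scalePosterior k d c u) := by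
    rw [integral_sub (integrable_const _) hi]; simp [meanShrink]
  refine ⟨?_, ?_, fun A hA => ?_⟩
  · refine (ENNReal.ofReal_le_ofReal_iff (by positivity)).1 (le_trans (le_of_eq ?_) h1)
    have hi2 : Integrable (fun s => 1 - shrink s) (scalePosterior k d c u) :=
      (integrable_const _).sub hi
    rw [h2, ofReal_integral_eq_lintegral_ofReal hi2]
    · exact lintegral_congr_ae (he.mono fun s hs => by simp only [hs])
    · filter_upwards [ae_pos_scalePosterior] with s hs
      simpa using shrink_le_one hs.le
  · have : 0 ≤ ∫ s, 1 - shrink s ∂(scalePosterior k d c u) := by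
      refine integral_nonneg_of_ae ?_
      filter_upwards [ae_pos_scalePosterior] with s hs
      simpa using shrink_le_one hs.le
    linarith
  -- Markov's inequality again: 1 ≤ (1 + A) / (1 + s) when s ≤ A.
  · rw [ENNReal.ofReal_mul (by positivity), ← lintegral_indicator_one measurableSet_Iic]
    refine le_trans ?_ (mul_le_mul_right h1 _)
    rw [← lintegral_const_mul _ (by fun_prop)]
    refine lintegral_mono_ae ?_
    filter_upwards [ae_pos_scalePosterior] with s hs
    by_cases hsA : s ≤ A
    · rw [indicator_of_mem (mem_Iic.2 hsA), ← ENNReal.ofReal_mul (by positivity), Pi.one_apply,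
        ENNReal.one_le_ofReal, mul_one_div, one_le_div (by positivity)]
      linarith
    · rw [indicator_of_notMem (show s ∉ Iic A from hsA)]
      exact zero_le

end ShrinkBounds

/-! ### The three regimes of means. -/

section Regimes

variable {k : ℕ} {V : Matrix (Fin k) (Fin k) ℝ} {d α β ρ L K : ℝ}

theorem small_means_covered (hk : 0 < k) (hV : V.PosDef) (hd : 0 < d) (hd1 : d < 1) (hK : 0 < K)
    (hα : 0 < α) (hα1 : α < 1) (hρ : 0 < ρ) (hL : 0 < L) :
    ∀ᶠ c in 𝓝[>] 0, ∀ θ₀ ∈ smallMeans V K c,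
      1 - α ≤ (multivariateGaussian θ₀ V).real {x | θ₀ ∈ credibleSet V d c α ρ L x} := by
  obtain ⟨M, hM0, hM⟩ := exists_one_sub_le_chiSq k hα
  obtain ⟨B, hB0, hB⟩ := meanShrink_le_rpow_mul_exp k hd hd1
  set U := 2 * K + 2 * M
  have hU : 0 < U := by positivity
  -- Both errors in `le_radius` are taken equal to `a`, with 2a < 1 - α; `η₀` makes the mass of
  -- scales below η₀c at most `a`, and δc is then a lower bound for the radius.
  set a := (1 - α) / 4
  have ha : 0 < a := by simp only [a]; linarith
  obtain ⟨t, ht0, ht⟩ := exists_chiSq_Iic_le hk ha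
  set η₀ := a / (2 ^ (d + 1) * 2 ^ (k / 2 : ℝ) * Real.exp (U / 2)) with hη₀
  have hη0 : 0 < η₀ := by positivity
  set δ := t * η₀ / (1 + η₀) with hδ
  have hδ0 : 0 < δ := by positivity
  set e := d / (1 + ρ)
  have he0 : 0 < e := by positivity
  have hed : e < d := div_lt_self hd (by linarith)
  -- The required inequality divided by c^e; both exponents left are positive because e < d < 1.
  have hlim : ∀ᶠ c in 𝓝[>] (0 : ℝ),
      2 * K * c ^ (1 - e) + 2 * (B * Real.exp (U / 2)) ^ 2 * U * c ^ (2 * d - e) < L * δ ^ e := by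
    have h1 := ((tendsto_rpow_nhdsGT_zero (show 0 < 1 - e by linarith)).const_mul (2 * K)).add
      ((tendsto_rpow_nhdsGT_zero (show 0 < 2 * d - e by linarith)).const_mul
        (2 * (B * Real.exp (U / 2)) ^ 2 * U))
    rw [mul_zero, mul_zero, add_zero] at h1
    exact h1.eventually (gt_mem_nhds (by positivity))
  filter_upwards [hlim, Ioc_mem_nhdsGT one_pos] with c hc ⟨hc0, hc1⟩ θ₀ hθ
  obtain ⟨η, rfl⟩ := sqrtMap_surjective hV θ₀
  have hη : ‖η‖ ^ 2 ≤ K * c := by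
    rw [← mahalSq_sqrtMap hV]; exact hθ
  refine hM.trans (chiSq_le_multivariateGaussian hV fun z hz => ?_)
  rw [mem_credibleSet_iff hV hd hc0]
  set y := η + z
  have hy : ‖y‖ ^ 2 ≤ U := by
    have h := norm_add_sq_le_of_pos η z one_pos
    have : K * c ≤ K := mul_le_of_le_one_right hK.le hc1
    norm_num at h
    linarith
  set m := meanShrink k d c (‖y‖ ^ 2)
  have hm0 : 0 ≤ m := meanShrink_nonneg
  have hexp : Real.exp (‖y‖ ^ 2 / 2) ≤ Real.exp (U / 2) := Real.exp_le_exp.2 (by linarith)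
  have hm : m ≤ B * Real.exp (U / 2) * c ^ d :=
    calc m ≤ B * c ^ d * Real.exp (‖y‖ ^ 2 / 2) := hB c _ hc0 hc1 (sq_nonneg _)
      _ ≤ B * c ^ d * Real.exp (U / 2) := by gcongr
      _ = _ := by ring
  have hdist : ‖η - m • y‖ ^ 2 ≤
      2 * (K * c) + 2 * ((B * Real.exp (U / 2) * c ^ d) ^ 2 * U) := by
    have h := norm_add_sq_le_of_pos η (-(m • y)) one_pos
    rw [← sub_eq_add_neg, norm_neg, norm_smul, mul_pow, Real.norm_of_nonneg hm0] at h
    have h2 : m ^ 2 * ‖y‖ ^ 2 ≤ (B * Real.exp (U / 2) * c ^ d) ^ 2 * U := by gcongr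
    norm_num at h
    linarith
  have hr : δ * c ≤ radius V d c α (sqrtMap V y) := by
    have hA : 0 < η₀ * c := by positivity
    have hsh : 0 < shrink (η₀ * c) := by unfold shrink; positivity
    refine le_radius hV hd hc0 hα (by positivity) hA ha.le ha.le
      ((scalePosterior_Iic_le hd hc0 hc1 (sq_nonneg _)).trans (ENNReal.ofReal_le_ofReal ?_))
      ?_ (by simp only [a]; linarith)
    · calc 2 ^ (d + 1) * 2 ^ (k / 2 : ℝ) * Real.exp (‖y‖ ^ 2 / 2) * η₀
          ≤ 2 ^ (d + 1) * 2 ^ (k / 2 : ℝ) * Real.exp (U / 2) * η₀ := by gcongr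
        _ = a := by rw [hη₀]; field_simp
    · rw [← ENNReal.ofReal_toReal (measure_ne_top (chiSq k) _)]
      refine ENNReal.ofReal_le_ofReal (le_trans (measureReal_mono (Iic_subset_Iic.2 ?_)) ht)
      have hδc : δ * c = t * (η₀ * c / (1 + η₀)) := by rw [hδ]; ring
      rw [div_le_iff₀ hsh, shrink, hδc]
      refine mul_le_mul_of_nonneg_left ?_ ht0.le
      refine div_le_div_of_nonneg_left (by positivity) (by positivity) ?_
      nlinarith
  have hpow : δ ^ e * c ^ e ≤ radius V d c α (sqrtMap V y) ^ e := by
    rw [← Real.mul_rpow hδ0.le hc0.le]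
    exact Real.rpow_le_rpow (by positivity) hr he0.le
  have hce : 0 < c ^ e := by positivity
  have e1 : c ^ (1 - e) * c ^ e = c := by rw [← Real.rpow_add hc0]; simp
  have e2 : c ^ (2 * d - e) * c ^ e = (c ^ d) ^ 2 := by
    rw [← Real.rpow_add hc0, ← Real.rpow_natCast, ← Real.rpow_mul hc0.le]; congr 1; push_cast; ring
  calc ‖η - m • y‖ ^ 2 ≤ 2 * (K * c) + 2 * ((B * Real.exp (U / 2) * c ^ d) ^ 2 * U) := hdist
    _ = (2 * K * c ^ (1 - e) + 2 * (B * Real.exp (U / 2)) ^ 2 * U * c ^ (2 * d - e)) * c ^ e := by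
        linear_combination (-2 * K) * e1 - 2 * (B * Real.exp (U / 2)) ^ 2 * U * e2
    _ ≤ L * δ ^ e * c ^ e := by gcongr
    _ ≤ L * radius V d c α (sqrtMap V y) ^ e := by
        rw [mul_assoc]; gcongr

/-- The lower threshold of the intermediate means, relative to `c`. -/
noncomputable def threshold (c : ℝ) : ℝ := 1 / (c * Real.log (1 / c))

theorem tendsto_threshold : Tendsto threshold (𝓝[>] 0) atTop := by
  have h1 : Tendsto (fun c : ℝ => c * Real.log (1 / c)) (𝓝[>] 0) (𝓝[>] 0) := by
    refine tendsto_nhdsWithin_iff.2 ⟨?_, ?_⟩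
    · simpa using tendsto_rpow_mul_log_one_div one_pos
    · filter_upwards [tendsto_log_one_div.eventually_gt_atTop 0, self_mem_nhdsWithin] with c hc hc0
      exact mul_pos hc0 hc
  refine (tendsto_inv_nhdsGT_zero.comp h1).congr fun c => ?_
  simp [threshold]

theorem threshold_mul {c : ℝ} (hc : c ≠ 0) : threshold c * c = 1 / Real.log (1 / c) := by
  unfold threshold; field_simp

theorem tendsto_threshold_mul : Tendsto (fun c => threshold c * c) (𝓝[>] 0) (𝓝 0) := by
  have h : Tendsto (fun c : ℝ => 1 / Real.log (1 / c)) (𝓝[>] 0) (𝓝 0) := by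
    simp_rw [one_div (Real.log _)]
    exact tendsto_log_one_div.inv_tendsto_atTop
  refine h.congr' ?_
  filter_upwards [self_mem_nhdsWithin] with c hc using (threshold_mul (ne_of_gt hc)).symm

theorem exp_half_mul_log_one_div {c K : ℝ} (hc : 0 < c) :
    Real.exp (K * Real.log (1 / c) / 2) = c ^ (-(K / 2)) := by
  rw [Real.rpow_def_of_pos hc, one_div, Real.log_inv]
  congr 1; ring

theorem medium_means_not_covered (hV : V.PosDef) (hd : 0 < d) (hd1 : d < 1) (hK : 0 < K)
    (hKd : K < 2 * d) (hα : 0 < α) (hα1 : α < 1) (hρ : 0 < ρ) (hL : 0 < L) {ε : ℝ} (hε : 0 < ε) :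
    ∀ᶠ c in 𝓝[>] 0, ∀ θ₀ ∈ mediumMeans V threshold K c,
      1 - ε ≤ (multivariateGaussian θ₀ V).real {x | θ₀ ∉ credibleSet V d c α ρ L x} := by
  obtain ⟨M, hM0, hM⟩ := exists_one_sub_le_chiSq k hε
  obtain ⟨B, hB0, hB⟩ := meanShrink_le_rpow_mul_exp k hd hd1
  have hS : 0 ≤ secondMoment k := secondMoment_nonneg
  -- A level between `K` and 2d: half of the gap K' - K absorbs the factor 1 + δ and the other half
  -- absorbs the noise, while g > 0 makes m = O(c^g).
  set K' := (K + 2 * d) / 2 with hK'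
  have hK0 : 0 < K' := by positivity
  set g := d - K' / 2 with hgdef
  have hg : 0 < g := by simp only [g, K']; linarith
  set δ := (K' - K) / (2 * K) with hδ
  have hδ0 : 0 < δ := div_pos (by simp only [K']; linarith) (by positivity)
  set e := d / (1 + ρ)
  have he0 : 0 < e := by positivity
  have hlim1 : ∀ᶠ c in 𝓝[>] (0 : ℝ), (1 + 1 / δ) * M / ((K' - K) / 2) ≤ Real.log (1 / c) :=
    tendsto_log_one_div.eventually_ge_atTop _
  have hlim2 : ∀ᶠ c in 𝓝[>] (0 : ℝ),
      4 * K' * (c ^ (g / 2) * Real.log (1 / c)) + (2 * secondMoment k + 1) * c ^ (g / 2) < 1 := by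
    have h1 := ((tendsto_rpow_mul_log_one_div (half_pos hg)).const_mul (4 * K')).add
      ((tendsto_rpow_nhdsGT_zero (half_pos hg)).const_mul (2 * secondMoment k + 1))
    rw [mul_zero, mul_zero, add_zero] at h1
    exact h1.eventually (gt_mem_nhds one_pos)
  have hlim3 : ∀ᶠ c in 𝓝[>] (0 : ℝ),
      B ^ 2 * K' * (c ^ g * Real.log (1 / c)) ^ 2 +
        L * (B / α) ^ e * (c ^ (g / 2 * e) * Real.log (1 / c)) < 1 / 2 := by
    have h1 := (((tendsto_rpow_mul_log_one_div hg).pow 2).const_mul (B ^ 2 * K')).add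
      ((tendsto_rpow_mul_log_one_div (show 0 < g / 2 * e by positivity)).const_mul
        (L * (B / α) ^ e))
    rw [zero_pow two_ne_zero, mul_zero, mul_zero, add_zero] at h1
    exact h1.eventually (gt_mem_nhds (by norm_num))
  filter_upwards [hlim1, hlim2, hlim3, tendsto_log_one_div.eventually_gt_atTop 0,
    Ioc_mem_nhdsGT one_pos] with c hc2 hc3 hc4 hl0 ⟨hc0, hc1⟩ θ₀ hθ
  obtain ⟨η, rfl⟩ := sqrtMap_surjective hV θ₀
  rw [mediumMeans, mem_ofPred_eq, mahalSq_sqrtMap hV, threshold_mul hc0.ne'] at hθ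
  obtain ⟨hη1, hη2⟩ := hθ
  set l := Real.log (1 / c)
  refine hM.trans (chiSq_le_multivariateGaussian hV fun z hz => ?_)
  rw [mem_credibleSet_iff hV hd hc0, not_le]
  set y := η + z
  have hy : ‖y‖ ^ 2 ≤ K' * l := by
    have h := norm_add_sq_le_of_pos η z hδ0
    have h1 : (1 + δ) * K = K + (K' - K) / 2 := by rw [hδ]; field_simp
    have h2 : (1 + 1 / δ) * M ≤ (K' - K) / 2 * l := by
      rw [div_le_iff₀ (by simp only [K']; linarith)] at hc2; linarith
    have h3 : (1 + δ) * ‖η‖ ^ 2 ≤ (1 + δ) * (K * l) := by gcongr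
    have h4 : (1 + 1 / δ) * ‖z‖ ^ 2 ≤ (1 + 1 / δ) * M := by gcongr
    have h5 : (1 + δ) * (K * l) = (K + (K' - K) / 2) * l := by rw [← h1]; ring
    linarith
  set m := meanShrink k d c (‖y‖ ^ 2)
  have hm0 : 0 ≤ m := meanShrink_nonneg
  have hm : m ≤ B * c ^ g :=
    calc m ≤ B * c ^ d * Real.exp (‖y‖ ^ 2 / 2) := hB c _ hc0 hc1 (sq_nonneg _)
      _ ≤ B * c ^ d * Real.exp (K' * l / 2) := by gcongr
      _ = _ := by
        rw [exp_half_mul_log_one_div hc0, mul_assoc, ← Real.rpow_add hc0, ← sub_eq_add_neg]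
  -- Half of the exponent `g` is spent on absorbing ‖y‖², which may grow like log(1/c).
  have hr : radius V d c α (sqrtMap V y) ≤ B / α * c ^ (g / 2) := by
    refine (radius_le hV hd hc0 (q := B * c ^ g) (by positivity) hα hα1 hm).trans ?_
    have h1 : c ^ g = c ^ (g / 2) * c ^ (g / 2) := by
      rw [← Real.rpow_add hc0, add_halves]
    have h2 : (4 * ‖y‖ ^ 2 + 2 * secondMoment k + 1) * c ^ (g / 2) ≤ 1 := by
      refine le_trans ?_ hc3.le
      have : ‖y‖ ^ 2 * c ^ (g / 2) ≤ K' * l * c ^ (g / 2) := by gcongr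
      linarith
    rw [h1, div_mul_eq_mul_div]
    refine div_le_div_of_nonneg_right ?_ hα.le
    calc (4 * ‖y‖ ^ 2 + 2 * secondMoment k + 1) * (B * (c ^ (g / 2) * c ^ (g / 2)))
        = ((4 * ‖y‖ ^ 2 + 2 * secondMoment k + 1) * c ^ (g / 2)) * (B * c ^ (g / 2)) := by ring
      _ ≤ 1 * (B * c ^ (g / 2)) := by gcongr
      _ = _ := one_mul _
  have hpow : radius V d c α (sqrtMap V y) ^ e ≤ (B / α) ^ e * c ^ (g / 2 * e) := by
    rw [Real.rpow_mul hc0.le, ← Real.mul_rpow (by positivity) (by positivity)]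
    exact Real.rpow_le_rpow (radius_nonneg hV hα1 _) hr he0.le
  -- From ‖η‖² ≤ 2‖η - m y‖² + 2‖m y‖² and the lower threshold ‖η‖² ≥ 1 / l.
  have hdist : 1 / (2 * l) - (B * c ^ g) ^ 2 * (K' * l) ≤ ‖η - m • y‖ ^ 2 := by
    have h := norm_add_sq_le_of_pos (η - m • y) (m • y) one_pos
    rw [sub_add_cancel, norm_smul, mul_pow, Real.norm_of_nonneg hm0] at h
    have h2 : m ^ 2 * ‖y‖ ^ 2 ≤ (B * c ^ g) ^ 2 * (K' * l) := by gcongr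
    have h3 : 1 / (2 * l) = 1 / l / 2 := by field_simp
    norm_num at h
    rw [h3]
    linarith
  refine lt_of_lt_of_le ?_ hdist
  calc L * radius V d c α (sqrtMap V y) ^ e ≤ L * ((B / α) ^ e * c ^ (g / 2 * e)) := by gcongr
    _ < 1 / (2 * l) - (B * c ^ g) ^ 2 * (K' * l) := by
      rw [lt_sub_iff_add_lt, lt_div_iff₀ (by positivity)]
      nlinarith

theorem large_means_covered (hk : 0 < k) (hV : V.PosDef) (hd : 0 < d) (hK : 2 * d < K)
    (hα : 0 < α) (hα1 : α < 1) (hαβ : α < β) (hβ1 : β < 1) (hρ : 0 < ρ)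
    (hL : chiSqUpper k α * chiSqUpper k β ^ (-d / (1 + ρ)) < L) :
    ∀ᶠ c in 𝓝[>] 0, ∀ θ₀ ∈ largeMeans V K c,
      1 - α ≤ (multivariateGaussian θ₀ V).real {x | θ₀ ∈ credibleSet V d c α ρ L x} := by
  have hβ0 : 0 < β := hα.trans hαβ
  have hχ : 0 < chiSqUpper k β := chiSqUpper_pos hk hβ0 hβ1
  have hχα : 0 ≤ chiSqUpper k α := chiSqUpper_nonneg hα1
  set e := d / (1 + ρ)
  have he0 : 0 < e := by positivity
  have hL0 : 0 < L := lt_of_le_of_lt (by positivity) hL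
  have hLχ : chiSqUpper k α < L * chiSqUpper k β ^ e := by
    rw [neg_div, Real.rpow_neg hχ.le, ← div_eq_mul_inv, div_lt_iff₀ (by positivity)] at hL
    exact hL
  -- The strict lower bound on `L` is spent in stages: `M` exceeds the α-quantile, so the noise ball
  -- has mass at least 1 - α, and t < t' lie below the β-quantile with M < L t^e still true.
  obtain ⟨M, hM1, hM2⟩ := exists_between hLχ
  have hM0 : 0 < M := hχα.trans_lt hM1
  have hcov : 1 - α ≤ (chiSq k).real (Iic M) := one_sub_le_chiSq_of_upper_lt hα hM1
  obtain ⟨t, ⟨ht0, htχ⟩, htM⟩ : ∃ t, (0 < t ∧ t < chiSqUpper k β) ∧ M < L * t ^ e := by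
    have h1 : Tendsto (fun t : ℝ => L * t ^ e) (𝓝[<] (chiSqUpper k β))
        (𝓝 (L * chiSqUpper k β ^ e)) :=
      (((Real.continuousAt_rpow_const _ e (Or.inr he0.le)).tendsto).const_mul L).mono_left
        nhdsWithin_le_nhds
    obtain ⟨t, h2, h3⟩ := ((h1.eventually (lt_mem_nhds hM2)).and (Ioo_mem_nhdsLT hχ)).exists
    exact ⟨t, h3, h2⟩
  obtain ⟨t', htt', ht'χ⟩ := exists_between htχ
  -- Chosen so that t / shrink A = t': scales above `A` shrink so little that a ball of squared
  -- radius `t` has conditional mass at most `b`.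
  set A := t / (t' - t) with hAdef
  have htt0 : 0 < t' - t := by linarith
  have hA : 0 < A := by positivity
  have hsA : t / shrink A = t' := by
    rw [shrink, hAdef]
    field_simp
    ring
  set b := (chiSq k).real (Iic t') with hb
  have hb0 : 0 ≤ b := measureReal_nonneg
  have hb1 : b < 1 - β := chiSq_lt_of_lt_upper hβ1 ht'χ
  -- Positive because b < 1 - β < 1 - α: this is the room that α < β provides in `le_radius`.
  set a := ((1 - α) - b) / 2 with ha
  have ha0 : 0 < a := by simp only [a]; linarith
  -- The slack between credible radius and noise, available for the bias (1 - m)‖y‖.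
  set δ₁ := Real.sqrt (L * t ^ e) - Real.sqrt M with hδ₁
  have hδ1 : 0 < δ₁ := sub_pos.2 (Real.sqrt_lt_sqrt hM0.le htM)
  set K' := (K + 2 * d) / 2 with hK'
  have hK'd : 2 * d < K' := by simp only [K']; linarith
  have hK'0 : 0 < K' := by linarith
  have hKK' : 0 < K - K' := by simp only [K']; linarith
  set δ := (K - K') / (2 * K') with hδ
  have hδ0 : 0 < δ := by positivity
  obtain ⟨B, hB0, hB⟩ := one_sub_meanShrink_le k hd hK'd
  obtain ⟨N, hN⟩ : ∃ N : ℝ, ∀ u, N ≤ u → B * u ^ (-(1 / 4) : ℝ) < δ₁ ∧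
      (1 + A) * (B * u ^ (-(3 / 4) : ℝ)) < a := by
    have h1 := (tendsto_rpow_neg_atTop (show (0 : ℝ) < 1 / 4 by norm_num)).const_mul B
    have h2 := ((tendsto_rpow_neg_atTop (show (0 : ℝ) < 3 / 4 by norm_num)).const_mul B).const_mul
      (1 + A)
    rw [mul_zero] at h1
    rw [mul_zero, mul_zero] at h2
    exact eventually_atTop.1
      ((h1.eventually (gt_mem_nhds hδ1)).and (h2.eventually (gt_mem_nhds ha0)))
  filter_upwards [tendsto_log_one_div.eventually_ge_atTop ((1 + 1 / δ) * M / ((K - K') / 2)),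
    tendsto_log_one_div.eventually_ge_atTop (max 1 N / K'), Ioc_mem_nhdsGT one_pos]
    with c hc2 hc3 ⟨hc0, hc1⟩ θ₀ hθ
  obtain ⟨η, rfl⟩ := sqrtMap_surjective hV θ₀
  rw [largeMeans, mem_ofPred_eq, mahalSq_sqrtMap hV] at hθ
  set l := Real.log (1 / c)
  refine hcov.trans (chiSq_le_multivariateGaussian hV fun z hz => ?_)
  rw [mem_credibleSet_iff hV hd hc0]
  set y := η + z with hydef
  have hy : K' * l ≤ ‖y‖ ^ 2 := by
    have h := norm_add_sq_le_of_pos y (-z) hδ0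
    rw [norm_neg, hydef, add_neg_cancel_right, ← hydef] at h
    have h1 : (1 + δ) * K' = K' + (K - K') / 2 := by rw [hδ]; field_simp
    have h2 : (1 + 1 / δ) * M ≤ (K - K') / 2 * l := by
      rw [div_le_iff₀ (by linarith)] at hc2; linarith
    have h4 : (1 + 1 / δ) * ‖z‖ ^ 2 ≤ (1 + 1 / δ) * M := by gcongr
    have h5 : (1 + δ) * (K' * l) = (K' + (K - K') / 2) * l := by rw [← h1]; ring
    have h6 : (1 + δ) * (K' * l) ≤ (1 + δ) * ‖y‖ ^ 2 := by linarith
    exact le_of_mul_le_mul_left h6 (by positivity)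
  have hu : max 1 N ≤ ‖y‖ ^ 2 := by
    rw [div_le_iff₀ hK'0] at hc3; linarith
  have hu1 : 1 ≤ ‖y‖ ^ 2 := (le_max_left _ _).trans hu
  have hy0 : 0 < ‖y‖ := by
    rcases (norm_nonneg y).eq_or_lt with h | h
    · rw [← h] at hu1; norm_num at hu1
    · exact h
  obtain ⟨hN1, hN2⟩ := hN _ ((le_max_right _ _).trans hu)
  obtain ⟨hm1, hm2, hm3⟩ := hB c _ hc0 hc1 hu1 hy
  set m := meanShrink k d c (‖y‖ ^ 2)
  have hr : t ≤ radius V d c α (sqrtMap V y) := by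
    refine le_radius hV hd hc0 hα ht0.le hA ha0.le hb0
      ((hm3 A hA).trans (ENNReal.ofReal_le_ofReal hN2.le)) ?_ (by simp only [a]; linarith)
    rw [hsA, hb, measureReal_def, ENNReal.ofReal_toReal (measure_ne_top _ _)]
  have hdist : ‖η - m • y‖ ≤ Real.sqrt (L * t ^ e) := by
    have h1 : η - m • y = (1 - m) • y - z := by
      rw [sub_smul, one_smul, hydef]; abel
    have h2 : ‖(1 - m) • y‖ ≤ δ₁ := by
      rw [norm_smul, Real.norm_of_nonneg (by linarith)]
      have h3 : (‖y‖ ^ 2) ^ (-(3 / 4) : ℝ) * ‖y‖ = (‖y‖ ^ 2) ^ (-(1 / 4) : ℝ) := by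
        have h4 : ‖y‖ = (‖y‖ ^ 2) ^ (1 / 2 : ℝ) := by
          rw [← Real.sqrt_eq_rpow, Real.sqrt_sq hy0.le]
        nth_rewrite 2 [h4]
        rw [← Real.rpow_add (by positivity)]
        norm_num
      calc (1 - m) * ‖y‖ ≤ B * (‖y‖ ^ 2) ^ (-(3 / 4) : ℝ) * ‖y‖ := by gcongr
        _ = B * (‖y‖ ^ 2) ^ (-(1 / 4) : ℝ) := by rw [mul_assoc, h3]
        _ ≤ δ₁ := hN1.le
    have h5 : ‖z‖ ≤ Real.sqrt M := Real.le_sqrt_of_sq_le hz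
    rw [h1]
    have h6 := norm_sub_le ((1 - m) • y) z
    linarith
  calc ‖η - m • y‖ ^ 2 ≤ Real.sqrt (L * t ^ e) ^ 2 := by gcongr
    _ = L * t ^ e := Real.sq_sqrt (by positivity)
    _ ≤ L * radius V d c α (sqrtMap V y) ^ e := by gcongr

end Regimes

end EIG

theorem theorem7 :
    ∃ f : ℝ → ℝ, Tendsto f (𝓝[>] 0) atTop ∧ Tendsto (fun c => f c * c) (𝓝[>] 0) (𝓝 0) ∧
      ∀ (k : ℕ) (_ : 0 < k) (V : Matrix (Fin k) (Fin k) ℝ) (_ : V.PosDef)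
        (d : ℝ) (_ : 0 < d) (_ : d < 1)
        (KS KM KL : ℝ) (_ : 0 < KS) (_ : 0 < KM) (_ : KM < 2 * d) (_ : 2 * d < KL)
        (α : ℝ) (_ : 0 < α) (_ : α < 1 / 2) (β : ℝ) (_ : α < β) (_ : β < 1) (ρ : ℝ) (_ : 0 < ρ)
        (L : ℝ) (_ : EIG.chiSqUpper k α * EIG.chiSqUpper k β ^ (-d / (1 + ρ)) < L)
        (c : ℕ → ℝ) (_ : ∀ n, 0 < c n) (_ : Tendsto c atTop (𝓝 0)),
        (∀ᶠ n in atTop, ∀ θ₀ ∈ EIG.smallMeans V KS (c n),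
          1 - α ≤ (multivariateGaussian θ₀ V).real
            {x | θ₀ ∈ EIG.credibleSet V d (c n) α ρ L x}) ∧
        (∀ ε : ℝ, 0 < ε → ∀ᶠ n in atTop, ∀ θ₀ ∈ EIG.mediumMeans V f KM (c n),
          1 - ε ≤ (multivariateGaussian θ₀ V).real
            {x | θ₀ ∉ EIG.credibleSet V d (c n) α ρ L x}) ∧
        (∀ᶠ n in atTop, ∀ θ₀ ∈ EIG.largeMeans V KL (c n),
          1 - α ≤ (multivariateGaussian θ₀ V).real
            {x | θ₀ ∈ EIG.credibleSet V d (c n) α ρ L x}) := by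
  -- A choice independent of all parameters is possible because f'(c)c = 1 / log(1/c) decays more
  -- slowly than every power of c.
  refine ⟨EIG.threshold, EIG.tendsto_threshold, EIG.tendsto_threshold_mul, ?_⟩
  intro k hk V hV d hd hd1 KS KM KL hKS hKM hKMd hKL α hα hα2 β hαβ hβ ρ hρ L hL c hc hc0
  have hα1 : α < 1 := by linarith
  have hL0 : 0 < L := lt_of_le_of_lt (mul_nonneg (EIG.chiSqUpper_nonneg hα1)
    (Real.rpow_nonneg (EIG.chiSqUpper_nonneg hβ) _)) hL
  have hlim : Tendsto c atTop (𝓝[>] 0) :=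
    tendsto_nhdsWithin_iff.2 ⟨hc0, Eventually.of_forall hc⟩
  exact ⟨hlim.eventually (EIG.small_means_covered hk hV hd hd1 hKS hα hα1 hρ hL0),
    fun ε hε => hlim.eventually
      (EIG.medium_means_not_covered hV hd hd1 hKM hKMd hα hα1 hρ hL0 hε),
    hlim.eventually (EIG.large_means_covered hk hV hd hKL hα hα1 hαβ hβ hρ hL)⟩
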